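/- **Setting.** Let $k$ be an algebraically closed field of characteristic $p>0$. For $S\in\{E_6,E_7,E_8\}$ put $r_{\max}(2,E_6)=1$, $r_{\max}(2,E_7)=3$, $r_{\max}(2,E_8)=4$, $r_{\max}(3,E_6)=r_{\max}(3,E_7)=1$, $r_{\max}(3,E_8)=2$, $r_{\max}(5,E_8)=1$. For $0\le r\le r_{\max}(p,S)$, a Noetherian local $k$-algebra $(A,\mathfrak m_A)$ is called a rational double point (RDP) of type $S^r$ if its completion is isomorphic, as a $k$-algebra, to $k[[x,y,z]]/(f)$, where $f$ is Artin's equation: - $p=2$, $E_6^r$: $z^2+x^3+y^2z+\beta$, with $\beta=xyz,\,0$ for $r=1,0$; - $p=2$, $E_7^r$: $z^2+x^3+xy^3+\beta$, with $\beta=zxy,\ zy^3,\ zx^2y,\ 0$ for $r=3,2,1,0$; - $p=2$, $E_8^r$: $z^2+x^3+y^5+\beta$, with $\beta=zxy,\ zy^3,\ zxy^2,\ zxy^3,\ 0$ for $r=4,3,2,1,0$; - $p=3$, $E_6^r$: $z^2+x^3+y^4+\beta$, and $E_7^r$: $z^2+x^3+xy^3+\beta$, in both cases with $\beta=x^2y^2,\,0$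 for $r=1,0$; - $p=3$, $E_8^r$: $z^2+x^3+y^5+\beta$, with $\beta=x^2y^2,\ x^2y^3,\ 0$ for $r=2,1,0$; - $p=5$, $E_8^r$: $z^2+x^3+y^5+\beta$, with $\beta=xy^4,\,0$ for $r=1,0$. Let $W_n(A)$ be the ring of $p$-typical Witt vectors of length $n\ge1$. For any $x,y\in A$ generating an ideal with radical $\mathfrak m_A$, the second local cohomology group is computed by the Čech complex: $$H^2_{\mathfrak m_A}(W_n(A))=\operatorname{Coker}\bigl(W_n(A[x^{-1}])\oplus W_n(A[y^{-1}])\to W_n(A[(xy)^{-1}])\bigr).$$ The Frobenius $F(a_0,\dots,a_{n-1})=(a_0^p,\dots,a_{n-1}^p)$, the iterated restriction $R^{n-1}(a_0,\dots,a_{n-1})=a_0$ and the iterated Verschiebung $V^{n-1}(a)=(0,\dots,0,a)$ induce maps $F$ on $H^2_{\mathfrak m_A}(W_n(A))$, $R^{n-1}:H^2_{\mathfrak m_A}(W_n(A))\to H^2_{\mathfrak m_A}(A)$ and $V^{n-1}:H^2_{\mathfrak m_A}(A)\to H^2_{\mathfrak m_A}(W_n(A))$. Write $H^2_{\mathfrak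 m_A}(W_n(A))[\mathfrak m_A]$ for the submodule of classes annihilated by all elements of $W_n(A)$ whose first component $a_0$ lies in $\mathfrak m_A$. **Proposition 4.7.** Suppose that a prime $p$, a Dynkin diagram $S$ and a positive integer $n$ satisfy one of the following: 1. $p=2$, $S\in\{E_7,E_8\}$, $n\le3$; 2. $p=3$, $S=E_8$, $n\le2$; 3. $p=2$, $S=E_6$, $n=1$; 4. $p=3$, $S\in\{E_6,E_7\}$, $n=1$; 5. $p=5$, $S=E_8$, $n=1$. Let $A$ be an RDP of type $S^r$ in characteristic $p$ with $0\le r\le r_{\max}(p,S)+1-n$. Then there is an element $e\in H^2_{\mathfrak m_A}(W_n(A))[\mathfrak m_A]$ such that $R^{n-1}(e)$ is a generator of the $A$-module $H^2_{\mathfrak m_A}(A)[\mathfrak m_A]$ and $$F(e)=\begin{cases}0&\text{if } r<r_{\max}(p,S)+1-n,\\ V^{n-1}(e')&\text{if } r=r_{\max}(p,S)+1-n,\end{cases}$$ where, in the second case, $e'$ is some generator of $H^2_{\mathfrak m_A}(A)[\mathfrak m_A]$. -/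

import Mathlib

universe u v

noncomputable section

/-! ## Truncated Witt vectors: functoriality, Verschiebung -/

namespace WittLC

/-- The ring homomorphism `W_n(f) : W_n(R) → W_n(S)`, `(a₀, a₁, …) ↦ (f a₀, f a₁, …)`. -/
def wittMap (p : ℕ) [Fact p.Prime] (n : ℕ) {R S : Type*} [CommRing R] [CommRing S]
    (f : R →+* S) : TruncatedWittVector p n R →+* TruncatedWittVector p n S :=
  have key : ∀ x : WittVector p R,
      TruncatedWittVector.mk p (fun i => f ((WittVector.truncate n x).coeff i)) =
        WittVector.truncate n (WittVector.map f x) := fun x => by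
    ext i
    simp [WittVector.coeff_truncate]
  have surj := WittVector.truncate_surjective p n R
  { toFun := fun x => TruncatedWittVector.mk p (fun i => f (x.coeff i))
    map_zero' := by
      have h := key 0
      rw [map_zero, map_zero, map_zero] at h
      exact h
    map_one' := by
      have h := key 1
      rw [map_one, map_one, map_one] at h
      exact h
    map_add' := fun x y => by
      obtain ⟨x, rfl⟩ := surj x
      obtain ⟨y, rfl⟩ := surj y
      rw [← map_add, key, key, key, map_add, map_add]
    map_mul' := fun x y => by
      obtain ⟨x, rfl⟩ := surj x
      obtain ⟨y, rfl⟩ := surj y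
      rw [← map_mul, key, key, key, map_mul, map_mul] }

@[simp]
theorem coeff_wittMap (p : ℕ) [Fact p.Prime] (n : ℕ) {R S : Type*} [CommRing R] [CommRing S]
    (f : R →+* S) (x : TruncatedWittVector p n R) (i : Fin n) :
    (wittMap p n f x).coeff i = f (x.coeff i) := rfl

theorem wittMap_comp (p : ℕ) [Fact p.Prime] (n : ℕ) {R S T : Type*} [CommRing R] [CommRing S]
    [CommRing T] (g : S →+* T) (f : R →+* S) (x : TruncatedWittVector p n R) :
    wittMap p n g (wittMap p n f x) = wittMap p n (g.comp f) x := rfl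

theorem coeff_iterate_verschiebung {p : ℕ} [Fact p.Prime] {R : Type*} [CommRing R]
    (x : WittVector p R) (k i : ℕ) :
    (WittVector.verschiebung^[k] x).coeff i = if i < k then 0 else x.coeff (i - k) := by
  induction k generalizing i with
  | zero => simp
  | succ k ih =>
    rw [Function.iterate_succ_apply']
    cases i with
    | zero => simp
    | succ i =>
      rw [WittVector.verschiebung_coeff_succ, ih]
      simp

/-- The iterated Verschiebung `V^{n-m} : W_m(R) → W_n(R)` for `m ≤ n`, which puts `n - m` zeros in
front of the components. -/
def verschiebungPow (p : ℕ) [Fact p.Prime] {m n : ℕ} (h : m ≤ n) (R : Type*) [CommRing R] :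
    TruncatedWittVector p m R →+ TruncatedWittVector p n R :=
  have key : ∀ x : WittVector p R,
      TruncatedWittVector.mk p (fun i : Fin n =>
        if hi : i.1 < n - m then 0
        else (WittVector.truncate m x).coeff ⟨i.1 - (n - m), by omega⟩) =
      WittVector.truncate n (WittVector.verschiebung^[n - m] x) := fun x => by
    ext i
    rw [WittVector.coeff_truncate, coeff_iterate_verschiebung, TruncatedWittVector.coeff_mk]
    split_ifs
    · rfl
    · rw [WittVector.coeff_truncate]
  have surj := WittVector.truncate_surjective p m R
  { toFun := fun x => TruncatedWittVector.mk p (fun i : Fin n =>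
      if hi : i.1 < n - m then 0 else x.coeff ⟨i.1 - (n - m), by omega⟩)
    map_zero' := by
      have h := key 0
      rw [map_zero, iterate_map_zero, map_zero] at h
      exact h
    map_add' := fun x y => by
      obtain ⟨x, rfl⟩ := surj x
      obtain ⟨y, rfl⟩ := surj y
      rw [← map_add, key, key, key, iterate_map_add, map_add] }

theorem coeff_verschiebungPow (p : ℕ) [Fact p.Prime] {m n : ℕ} (h : m ≤ n) {R : Type*} [CommRing R]
    (x : TruncatedWittVector p m R) (i : Fin n) :
    (verschiebungPow p h R x).coeff i =
      if hi : i.1 < n - m then 0 else x.coeff ⟨i.1 - (n - m), by omega⟩ := rfl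

theorem wittMap_verschiebungPow (p : ℕ) [Fact p.Prime] {m n : ℕ} (h : m ≤ n) {R S : Type*}
    [CommRing R] [CommRing S] (f : R →+* S) (x : TruncatedWittVector p m R) :
    wittMap p n f (verschiebungPow p h R x) = verschiebungPow p h S (wittMap p m f x) := by
  ext i
  rw [coeff_wittMap, coeff_verschiebungPow, coeff_verschiebungPow]
  split_ifs
  · exact map_zero f
  · rw [coeff_wittMap]

theorem wittMap_truncate (p : ℕ) [Fact p.Prime] {m n : ℕ} (h : m ≤ n) {R S : Type*}
    [CommRing R] [CommRing S] (f : R →+* S) (x : TruncatedWittVector p n R) :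
    wittMap p m f (TruncatedWittVector.truncate h x) =
      TruncatedWittVector.truncate h (wittMap p n f x) := by
  ext i
  rw [coeff_wittMap, TruncatedWittVector.coeff_truncate, TruncatedWittVector.coeff_truncate,
    coeff_wittMap]

/-- The Frobenius `a ↦ a ^ p` of a ring in which the prime `p` is zero (the zero ring is allowed,
so that this applies to every localization of a ring of characteristic `p`). -/
def frob (p : ℕ) [Fact p.Prime] {R : Type*} [CommRing R] (h : (p : R) = 0) : R →+* R where
  toFun a := a ^ p
  map_zero' := zero_pow (Fact.out : p.Prime).ne_zero
  map_one' := one_pow p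
  map_mul' a b := mul_pow a b p
  map_add' a b := by
    obtain ⟨r, hr⟩ := exists_add_pow_prime_eq (Fact.out : p.Prime) a b
    rw [hr, h]
    ring

theorem frob_naturality (p : ℕ) [Fact p.Prime] {R S : Type*} [CommRing R] [CommRing S]
    (hR : (p : R) = 0) (hS : (p : S) = 0) (f : R →+* S) :
    (frob p hS).comp f = f.comp (frob p hR) :=
  RingHom.ext fun a => (map_pow f a p).symm

theorem natCast_localization_eq_zero (p : ℕ) {A : Type*} [CommRing A] [CharP A p]
    (M : Submonoid A) : ((p : ℕ) : Localization M) = 0 := by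
  rw [← map_natCast (algebraMap A (Localization M)) p, CharP.cast_eq_zero A p, map_zero]

/-! ## The local cohomology groups `H²_𝔪(W_n(A))` -/

/-- `W_n` of a localization of `A` is a `W_n(A)`-algebra. -/
instance wittAlgebra (p : ℕ) [Fact p.Prime] (n : ℕ) {A : Type*} [CommRing A] (M : Submonoid A) :
    Algebra (TruncatedWittVector p n A) (TruncatedWittVector p n (Localization M)) :=
  (wittMap p n (algebraMap A (Localization M))).toAlgebra

/-- The localization map `A[1/x] → A[1/(xy)]`. -/
abbrev locLeft {A : Type*} [CommRing A] (x y : A) :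
    Localization.Away x →+* Localization.Away (x * y) :=
  IsLocalization.Away.awayToAwayRight x y

/-- The localization map `A[1/y] → A[1/(xy)]`. -/
abbrev locRight {A : Type*} [CommRing A] (x y : A) :
    Localization.Away y →+* Localization.Away (x * y) :=
  IsLocalization.Away.awayToAwayLeft y x

/-- The degree two coboundaries of the Čech complex
`W_n(A) → W_n(A[1/x]) ⊕ W_n(A[1/y]) → W_n(A[1/(xy)])`: the image of the last map, as a
`W_n(A)`-submodule of `W_n(A[1/(xy)])`. -/
def cechBoundary (p : ℕ) [Fact p.Prime] (n : ℕ) {A : Type*} [CommRing A] (x y : A) :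
    Submodule (TruncatedWittVector p n A) (TruncatedWittVector p n (Localization.Away (x * y))) where
  carrier := {t | ∃ a b, t = wittMap p n (locLeft x y) a + wittMap p n (locRight x y) b}
  zero_mem' := ⟨0, 0, by simp⟩
  add_mem' := by
    rintro _ _ ⟨a, b, rfl⟩ ⟨a', b', rfl⟩
    exact ⟨a + a', b + b', by rw [map_add, map_add]; ring⟩
  smul_mem' := by
    rintro c _ ⟨a, b, rfl⟩
    refine ⟨wittMap p n (algebraMap A _) c * a, wittMap p n (algebraMap A _) c * b, ?_⟩
    have h1 : wittMap p n (locLeft x y) (wittMap p n (algebraMap A (Localization.Away x)) c) =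
        wittMap p n (algebraMap A (Localization.Away (x * y))) c := by
      rw [wittMap_comp]
      congr 2
      exact RingHom.ext fun a => IsLocalization.Away.awayToAwayRight_eq x y a
    have h2 : wittMap p n (locRight x y) (wittMap p n (algebraMap A (Localization.Away y)) c) =
        wittMap p n (algebraMap A (Localization.Away (x * y))) c := by
      rw [wittMap_comp]
      congr 2
      exact RingHom.ext fun a => IsLocalization.Away.awayToAwayLeft_eq y x a
    rw [map_mul, map_mul, h1, h2, ← mul_add]
    rfl

/-- The second local cohomology group `H²_𝔪(W_n(A))` as a `W_n(A)`-module, computed by the Čech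
complex of two elements `x, y` that generate an ideal with radical `𝔪`:
`H²_𝔪(W_n(A)) = Coker (W_n(A[1/x]) ⊕ W_n(A[1/y]) → W_n(A[1/(xy)]))`. -/
abbrev LocCoh (p : ℕ) [Fact p.Prime] (n : ℕ) {A : Type*} [CommRing A] (x y : A) :=
  TruncatedWittVector p n (Localization.Away (x * y)) ⧸ cechBoundary p n x y

/-- An additive map `W_n(A[1/(xy)]) → W_m(A[1/(xy)])` that preserves the Čech coboundaries induces a
map `H²_𝔪(W_n(A)) → H²_𝔪(W_m(A))`. -/
def LocCoh.induced {p : ℕ} [Fact p.Prime] {n m : ℕ} {A : Type*} [CommRing A] {x y : A}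
    (φ : TruncatedWittVector p n (Localization.Away (x * y)) →+
      TruncatedWittVector p m (Localization.Away (x * y)))
    (hφ : ∀ t ∈ cechBoundary p n x y, φ t ∈ cechBoundary p m x y) :
    LocCoh p n x y →+ LocCoh p m x y :=
  QuotientAddGroup.map (cechBoundary p n x y).toAddSubgroup (cechBoundary p m x y).toAddSubgroup
    φ hφ

theorem LocCoh.induced_mk {p : ℕ} [Fact p.Prime] {n m : ℕ} {A : Type*} [CommRing A] {x y : A}
    (φ : TruncatedWittVector p n (Localization.Away (x * y)) →+
      TruncatedWittVector p m (Localization.Away (x * y)))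
    (hφ : ∀ t ∈ cechBoundary p n x y, φ t ∈ cechBoundary p m x y)
    (t : TruncatedWittVector p n (Localization.Away (x * y))) :
    LocCoh.induced φ hφ (Submodule.Quotient.mk t) = Submodule.Quotient.mk (φ t) := rfl

/-- The Frobenius `F : H²_𝔪(W_n(A)) → H²_𝔪(W_n(A))`, induced by
`(a₀, a₁, …) ↦ (a₀ ^ p, a₁ ^ p, …)`. -/
def LocCoh.F (p : ℕ) [Fact p.Prime] (n : ℕ) {A : Type*} [CommRing A] [CharP A p] (x y : A) :
    LocCoh p n x y →+ LocCoh p n x y :=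
  LocCoh.induced
    (wittMap p n (frob p (natCast_localization_eq_zero p (Submonoid.powers (x * y))))).toAddMonoidHom
    (by
      rintro _ ⟨a, b, rfl⟩
      refine ⟨wittMap p n (frob p (natCast_localization_eq_zero p _)) a,
        wittMap p n (frob p (natCast_localization_eq_zero p _)) b, ?_⟩
      rw [RingHom.toAddMonoidHom_eq_coe, AddMonoidHom.coe_coe, map_add, wittMap_comp, wittMap_comp,
        wittMap_comp, wittMap_comp,
        frob_naturality p (natCast_localization_eq_zero p (Submonoid.powers x)),
        frob_naturality p (natCast_localization_eq_zero p (Submonoid.powers y))])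

/-- The iterated restriction `R^{n-m} : H²_𝔪(W_n(A)) → H²_𝔪(W_m(A))` for `m ≤ n`. -/
def LocCoh.R (p : ℕ) [Fact p.Prime] {m n : ℕ} (h : m ≤ n) {A : Type*} [CommRing A] (x y : A) :
    LocCoh p n x y →+ LocCoh p m x y :=
  LocCoh.induced
    (TruncatedWittVector.truncate (p := p) (R := Localization.Away (x * y)) h).toAddMonoidHom
    (by
      rintro _ ⟨a, b, rfl⟩
      refine ⟨TruncatedWittVector.truncate h a, TruncatedWittVector.truncate h b, ?_⟩
      rw [RingHom.toAddMonoidHom_eq_coe, AddMonoidHom.coe_coe, map_add, wittMap_truncate,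
        wittMap_truncate])

/-- The iterated Verschiebung `V^{n-m} : H²_𝔪(W_m(A)) → H²_𝔪(W_n(A))` for `m ≤ n`. -/
def LocCoh.V (p : ℕ) [Fact p.Prime] {m n : ℕ} (h : m ≤ n) {A : Type*} [CommRing A] (x y : A) :
    LocCoh p m x y →+ LocCoh p n x y :=
  LocCoh.induced (verschiebungPow p h (Localization.Away (x * y)))
    (by
      rintro _ ⟨a, b, rfl⟩
      refine ⟨verschiebungPow p h _ a, verschiebungPow p h _ b, ?_⟩
      rw [map_add, wittMap_verschiebungPow, wittMap_verschiebungPow])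

/-- The `I`-torsion part `H²_𝔪(W_n(A))[I]`, for an ideal `I` of `A` and `n ≥ 1`: the classes
annihilated by the preimage `(R^{n-1})⁻¹(I)` of `I` in `W_n(A)`, that is, by the Witt vectors
whose component of index `0` lies in `I`. -/
def LocCoh.torsion (p : ℕ) [Fact p.Prime] {n : ℕ} (hn : 1 ≤ n) {A : Type*} [CommRing A] (x y : A)
    (I : Ideal A) : Submodule (TruncatedWittVector p n A) (LocCoh p n x y) :=
  Submodule.torsionBySet (TruncatedWittVector p n A) (LocCoh p n x y)
    {a | a.coeff ⟨0, hn⟩ ∈ I}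

/-- The class `g` is a generator of the `A`-module `H²_𝔪(A)[I]`, where `A = W_1(A)`. -/
def LocCoh.IsGenerator {p : ℕ} [Fact p.Prime] {A : Type*} [CommRing A] {x y : A}
    (I : Ideal A) (g : LocCoh p 1 x y) : Prop :=
  Submodule.span (TruncatedWittVector p 1 A) {g} = LocCoh.torsion p le_rfl x y I

end WittLC

/-! ## Rational double points of type `E_6`, `E_7`, `E_8` -/

namespace RDP

/-- The Dynkin diagrams of type `E`. -/
inductive EType
  | E6
  | E7
  | E8

open EType

/-- The number `r_max(p, S)`: there are `r_max(p, S) + 1` isomorphism classes of rational double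
points with Dynkin diagram `S` in characteristic `p`. -/
def rMax : ℕ → EType → ℕ
  | 2, E6 => 1
  | 2, E7 => 3
  | 2, E8 => 4
  | 3, E6 => 1
  | 3, E7 => 1
  | 3, E8 => 2
  | 5, E8 => 1
  | _, _ => 0

/-- Artin's equation for the rational double point of type `S^0` in characteristic `p`, evaluated
at elements `x, y, z` of a ring. -/
def equationZero {R : Type*} [CommRing R] (x y z : R) : ℕ → EType → R
  | 2, E6 => z ^ 2 + x ^ 3 + y ^ 2 * z
  | _, E6 => z ^ 2 + x ^ 3 + y ^ 4
  | _, E7 => z ^ 2 + x ^ 3 + x * y ^ 3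
  | _, E8 => z ^ 2 + x ^ 3 + y ^ 5

/-- The term that is added to the equation of `S^0` to obtain Artin's equation for `S^r`,
`0 ≤ r ≤ r_max(p, S)`. -/
def extraTerm {R : Type*} [CommRing R] (x y z : R) : ℕ → EType → ℕ → R
  | 2, E6, 1 => x * y * z
  | 2, E7, 3 => z * x * y
  | 2, E7, 2 => z * y ^ 3
  | 2, E7, 1 => z * x ^ 2 * y
  | 2, E8, 4 => z * x * y
  | 2, E8, 3 => z * y ^ 3
  | 2, E8, 2 => z * x * y ^ 2
  | 2, E8, 1 => z * x * y ^ 3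
  | 3, E6, 1 => x ^ 2 * y ^ 2
  | 3, E7, 1 => x ^ 2 * y ^ 2
  | 3, E8, 2 => x ^ 2 * y ^ 2
  | 3, E8, 1 => x ^ 2 * y ^ 3
  | 5, E8, 1 => x * y ^ 4
  | _, _, _ => 0

/-- Artin's equation of `S^r` in characteristic `p`, as a power series in `k[[x, y, z]]`. -/
def equation (k : Type*) [CommRing k] (p : ℕ) (S : EType) (r : ℕ) : MvPowerSeries (Fin 3) k :=
  equationZero (MvPowerSeries.X 0) (MvPowerSeries.X 1) (MvPowerSeries.X 2) p S +
    extraTerm (MvPowerSeries.X 0) (MvPowerSeries.X 1) (MvPowerSeries.X 2) p S r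

/-- The local `k`-algebra `A` is a rational double point of type `S^r` in characteristic `p`: its
completion is isomorphic to `k[[x, y, z]] / (f)`, where `f` is Artin's equation of `S^r`. -/
def IsOfType (k : Type u) [Field k] (A : Type v) [CommRing A] [IsLocalRing A] [Algebra k A]
    (p : ℕ) (S : EType) (r : ℕ) : Prop :=
  r ≤ rMax p S ∧
    Nonempty (AdicCompletion (IsLocalRing.maximalIdeal A) A ≃ₐ[k]
      MvPowerSeries (Fin 3) k ⧸ Ideal.span {equation k p S r})

end RDP

end

/-!
The completion of `A` is `B = k[[x, y, z]] / (f)` with `f` Artin's equation, and the explicit class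
`e = [z / (xy)]` in `H²_𝔪(W_n(B))`, where `[·]` is the Teichmüller representative, has the desired
properties.

Reduction to `B`. Every element of `W_n(A[1/(xy)])` is a fraction `b / [xy] ^ N` with
`b ∈ W_n(A)`, and such a fraction is a coboundary if and only if `[xy] ^ M b` lies in
`([x] ^ (N + M), [y] ^ (N + M))` for some `M` (`frac_mem_cechBoundary_iff`). Since these ideals are
cofinal with the ideals `W_n((x ^ N, y ^ N))` (`wittIdeal_le_teichIdeal`), the groups
`H²_𝔪(W_n(A))` do not change under completion (`nonempty_locCohIso_completion`). They do not depend
on the system of parameters either (`nonempty_locCohIso_of_radical_eq`): two systems that share an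
element are compared through a common refinement, and any two systems are joined by a chain of such
steps, because over the infinite field `k` a general linear combination of `x` and `y` completes a
given parameter. All these isomorphisms respect `F`, `R`, `V` and the torsion parts (`LocCohIso`),
so one may work with the images of the variables `x, y` in `B`.

The class in `B`. The equation is monic of degree two in `z` with lower coefficients in `(x, y)`.
Hence `x, y` is a regular sequence in `B`, and `z / (xy)` generates the socle of `H²_𝔪(B)`
(`IsDoubleCover.isGenerator`). A power of `z / (xy)`, or `z` times it, is written as `t + v` with
`t ∈ B[1/y]` and `v ∈ B[1/x]`, so that `[t]` and `[v]` are coboundaries. In length one this already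
computes the class. In characteristic two `[t] + [v] = [t + v] + V[tv]` in length two, and
`[t] + [v] = [t + v] + V[tv] + V²[t³v + tv³]` in length three, while in characteristic three
`[t + v] = [t] + [v] + V[t²v + tv²]` in length two. The cross terms are decomposed in the same way,
and the result is that `[z] e = 0` and `F e = V^{n-1}(c z / (xy))` with `c` a unit or zero
(`exists_teichFrobenius`). Finally `V(a) e = V(a F(e'))`, where `e'` is the class `[z / (xy)]` in
length `n - 1`, whose Frobenius vanishes; therefore `e` is annihilated by all Witt vectors whose
first component lies in the maximal ideal (`TeichFrobenius.mem_torsion`).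
-/

noncomputable section

/-! ### Teichmüller representatives in truncated Witt vectors -/

namespace WittLC

open WittVector in
theorem teichmuller_mul_coeff_aux (p : ℕ) [Fact p.Prime] {R : Type*} [CommRing R]
    [Invertible (p : R)] (a : R) (x : WittVector p R) :
    teichmuller p a * x = WittVector.mk p fun i => a ^ p ^ i * x.coeff i := by
  apply (ghostMap.bijective_of_invertible p R).1
  rw [map_mul]
  ext1 n
  simp only [Pi.mul_apply, ghostMap_apply, ghostComponent_teichmuller]
  rw [ghostComponent_apply, aeval_wittPolynomial, ghostComponent_apply, aeval_wittPolynomial,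
    Finset.mul_sum]
  refine Finset.sum_congr rfl fun i hi => ?_
  have hi' : i + (n - i) = n := by
    have := Finset.mem_range.1 hi
    omega
  rw [coeff_mk, mul_pow, ← pow_mul, ← pow_add, hi']
  ring

/-- Multiplication by a Teichmüller representative, in components. As for the ring axioms of Witt
vectors, the ghost map reduces the identity to a calculation over polynomial rings over `ℚ`. -/
theorem teichmuller_mul_coeff (p : ℕ) [Fact p.Prime] {R : Type*} [CommRing R]
    (a : R) (x : WittVector p R) (i : ℕ) :
    (WittVector.teichmuller p a * x).coeff i = a ^ p ^ i * x.coeff i := by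
  have hZ : ∀ (b : MvPolynomial R ℤ) (y : WittVector p (MvPolynomial R ℤ)),
      WittVector.teichmuller p b * y = WittVector.mk p fun i => b ^ p ^ i * y.coeff i := by
    intro b y
    refine WittVector.map_injective (MvPolynomial.map (Int.castRingHom ℚ))
      (MvPolynomial.map_injective _ Int.cast_injective) ?_
    rw [map_mul, WittVector.map_teichmuller, teichmuller_mul_coeff_aux]
    ext j
    simp [WittVector.map_coeff, map_mul, map_pow]
  obtain ⟨b, rfl⟩ := MvPolynomial.counit_surjective R a
  obtain ⟨y, rfl⟩ := WittVector.map_surjective (p := p) _ (MvPolynomial.counit_surjective R) x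
  rw [← WittVector.map_teichmuller, ← map_mul, hZ]
  simp [WittVector.map_coeff]

/-- The Teichmüller representative `[a] = (a, 0, …, 0)` in `W_n(R)`. -/
def teich (p : ℕ) [Fact p.Prime] (n : ℕ) {R : Type*} [CommRing R] :
    R →* TruncatedWittVector p n R :=
  ((WittVector.truncate n : WittVector p R →+* TruncatedWittVector p n R) :
    WittVector p R →* TruncatedWittVector p n R).comp (WittVector.teichmuller p)

section

variable {p : ℕ} [Fact p.Prime] {n : ℕ} {R S : Type*} [CommRing R] [CommRing S]

theorem teich_eq (a : R) :
    teich p n a = WittVector.truncate n (WittVector.teichmuller p a) := rfl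

theorem coeff_teich (a : R) (i : Fin n) :
    (teich p n a).coeff i = if i.1 = 0 then a else 0 := by
  rw [teich_eq, WittVector.coeff_truncate]
  split_ifs with h
  · rw [h, WittVector.teichmuller_coeff_zero]
  · exact WittVector.teichmuller_coeff_pos p a _ (Nat.pos_of_ne_zero h)

theorem coeff_teich_mul (a : R) (c : TruncatedWittVector p n R) (i : Fin n) :
    (teich p n a * c).coeff i = a ^ p ^ i.1 * c.coeff i := by
  obtain ⟨c, rfl⟩ := WittVector.truncate_surjective p n R c
  rw [teich_eq, ← map_mul, WittVector.coeff_truncate, WittVector.coeff_truncate,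
    teichmuller_mul_coeff]

theorem wittMap_teich (f : R →+* S) (a : R) :
    wittMap p n f (teich p n a) = teich p n (f a) := by
  ext i
  rw [coeff_wittMap, coeff_teich, coeff_teich]
  split_ifs
  · rfl
  · exact map_zero f

theorem teich_zero : teich p n (0 : R) = 0 := by
  rw [teich_eq, WittVector.teichmuller_zero, map_zero]

/-- Witt vectors with disjoint supports are added componentwise. -/
theorem coeff_add_of_disjoint (x y : TruncatedWittVector p n R)
    (h : ∀ i, x.coeff i = 0 ∨ y.coeff i = 0) (i : Fin n) :
    (x + y).coeff i = x.coeff i + y.coeff i := by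
  have hx : WittVector.truncate n x.out = x := TruncatedWittVector.truncateFun_out x
  have hy : WittVector.truncate n y.out = y := TruncatedWittVector.truncateFun_out y
  have key : ∀ j : ℕ, x.out.coeff j = 0 ∨ y.out.coeff j = 0 := by
    intro j
    by_cases hj : j < n
    · have := h ⟨j, hj⟩
      rwa [← TruncatedWittVector.coeff_out x, ← TruncatedWittVector.coeff_out y] at this
    · left
      simp [TruncatedWittVector.out, hj]
  conv_lhs => rw [← hx, ← hy, ← map_add]
  rw [WittVector.coeff_truncate, WittVector.coeff_add_of_disjoint _ _ _ key,
    TruncatedWittVector.coeff_out, TruncatedWittVector.coeff_out]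

/-- The components of index `≥ 1` of a Witt vector, shifted by one. -/
def wittTail (c : TruncatedWittVector p (n + 1) R) : TruncatedWittVector p n R :=
  TruncatedWittVector.mk p fun i => c.coeff i.succ

@[simp]
theorem coeff_wittTail (c : TruncatedWittVector p (n + 1) R) (i : Fin n) :
    (wittTail c).coeff i = c.coeff i.succ := TruncatedWittVector.coeff_mk _ i

theorem coeff_verschiebung_zero (c : TruncatedWittVector p n R) :
    (verschiebungPow p n.le_succ R c).coeff 0 = 0 := by
  rw [coeff_verschiebungPow, dif_pos]
  simp

theorem coeff_verschiebung_succ (c : TruncatedWittVector p n R) (i : Fin n) :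
    (verschiebungPow p n.le_succ R c).coeff i.succ = c.coeff i := by
  rw [coeff_verschiebungPow, dif_neg (by simp)]
  congr 1
  ext
  simp

theorem verschiebung_wittTail (c : TruncatedWittVector p (n + 1) R) (h : c.coeff 0 = 0) :
    verschiebungPow p n.le_succ R (wittTail c) = c := by
  ext i
  refine Fin.cases ?_ (fun i => ?_) i
  · rw [coeff_verschiebung_zero, h]
  · rw [coeff_verschiebung_succ, coeff_wittTail]

theorem teich_add_verschiebung_wittTail (c : TruncatedWittVector p (n + 1) R) :
    teich p (n + 1) (c.coeff 0) + verschiebungPow p n.le_succ R (wittTail c) = c := by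
  have h : ∀ i, (teich p (n + 1) (c.coeff 0)).coeff i = 0 ∨
      (verschiebungPow p n.le_succ R (wittTail c)).coeff i = 0 := by
    refine Fin.cases (Or.inr (coeff_verschiebung_zero _)) fun i => Or.inl ?_
    rw [coeff_teich, if_neg (by simp)]
  ext i
  rw [coeff_add_of_disjoint _ _ h]
  refine Fin.cases ?_ (fun i => ?_) i
  · rw [coeff_teich, if_pos (by simp), coeff_verschiebung_zero, add_zero]
  · rw [coeff_teich, if_neg (by simp), coeff_verschiebung_succ, coeff_wittTail, zero_add]

/-- The projection formula `[a] V(c) = V([a ^ p] c)`. -/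
theorem teich_mul_verschiebung (a : R) (c : TruncatedWittVector p n R) :
    teich p (n + 1) a * verschiebungPow p n.le_succ R c =
      verschiebungPow p n.le_succ R (teich p n (a ^ p) * c) := by
  ext i
  refine Fin.cases ?_ (fun i => ?_) i
  · rw [coeff_teich_mul, coeff_verschiebung_zero, coeff_verschiebung_zero, mul_zero]
  · rw [coeff_teich_mul, coeff_verschiebung_succ, coeff_verschiebung_succ, coeff_teich_mul,
      Fin.val_succ, pow_succ' p, pow_mul]

theorem wittMap_eq_zero_iff (f : R →+* S) (c : TruncatedWittVector p n R) :
    wittMap p n f c = 0 ↔ ∀ i, f (c.coeff i) = 0 := by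
  constructor
  · intro h i
    rw [← coeff_wittMap, h, TruncatedWittVector.coeff_zero]
  · intro h
    ext i
    rw [coeff_wittMap, h, TruncatedWittVector.coeff_zero]

/-- The ideal `W_n(J)` of the Witt vectors with components in an ideal `J`. -/
def wittIdeal (p : ℕ) [Fact p.Prime] (n : ℕ) (J : Ideal R) : Ideal (TruncatedWittVector p n R) :=
  RingHom.ker (wittMap p n (Ideal.Quotient.mk J))

theorem mem_wittIdeal {J : Ideal R} {c : TruncatedWittVector p n R} :
    c ∈ wittIdeal p n J ↔ ∀ i, c.coeff i ∈ J := by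
  rw [wittIdeal, RingHom.mem_ker, wittMap_eq_zero_iff]
  simp only [Ideal.Quotient.eq_zero_iff_mem]

theorem teich_mem_wittIdeal {J : Ideal R} {a : R} (h : a ∈ J) :
    teich p n a ∈ wittIdeal p n J := by
  rw [mem_wittIdeal]
  intro i
  rw [coeff_teich]
  split_ifs
  · exact h
  · exact J.zero_mem

theorem coeff_zero_add (x y : TruncatedWittVector p (n + 1) R) :
    (x + y).coeff 0 = x.coeff 0 + y.coeff 0 := by
  obtain ⟨x, rfl⟩ := WittVector.truncate_surjective p _ R x
  obtain ⟨y, rfl⟩ := WittVector.truncate_surjective p _ R y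
  rw [← map_add, WittVector.coeff_truncate, WittVector.coeff_truncate, WittVector.coeff_truncate]
  exact WittVector.add_coeff_zero x y

theorem coeff_zero_sub (x y : TruncatedWittVector p (n + 1) R) :
    (x - y).coeff 0 = x.coeff 0 - y.coeff 0 := by
  rw [eq_sub_iff_add_eq, ← coeff_zero_add, sub_add_cancel]

theorem coeff_zero_mul (x y : TruncatedWittVector p (n + 1) R) :
    (x * y).coeff 0 = x.coeff 0 * y.coeff 0 := by
  obtain ⟨x, rfl⟩ := WittVector.truncate_surjective p _ R x
  obtain ⟨y, rfl⟩ := WittVector.truncate_surjective p _ R y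
  rw [← map_mul, WittVector.coeff_truncate, WittVector.coeff_truncate, WittVector.coeff_truncate]
  exact WittVector.mul_coeff_zero x y

/-- The ideal `([x] ^ N, [y] ^ N)` of `W_n(R)`. -/
def teichIdeal (p : ℕ) [Fact p.Prime] (n : ℕ) (x y : R) (N : ℕ) :
    Ideal (TruncatedWittVector p n R) :=
  Ideal.span {teich p n x ^ N, teich p n y ^ N}

theorem teichIdeal_le_wittIdeal (x y : R) (N : ℕ) :
    teichIdeal p n x y N ≤ wittIdeal p n (Ideal.span {x ^ N, y ^ N}) := by
  rw [teichIdeal, Ideal.span_le]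
  rintro _ (rfl | rfl) <;> rw [← map_pow (teich p n)] <;>
    exact teich_mem_wittIdeal (Ideal.subset_span (by simp))

/-- The filtrations of `W_n(R)` by the ideals `([x] ^ N, [y] ^ N)` and `W_n((x ^ N, y ^ N))` are
cofinal; the other comparison is `teichIdeal_le_wittIdeal`. -/
theorem wittIdeal_le_teichIdeal (x y : R) (N : ℕ) :
    wittIdeal p n (Ideal.span {x ^ (N * p ^ n), y ^ (N * p ^ n)}) ≤ teichIdeal p n x y N := by
  induction n generalizing N with
  | zero =>
    intro c _
    have : c = 0 := by
      ext i
      exact i.elim0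
    rw [this]
    exact Ideal.zero_mem _
  | succ n ih =>
    intro c hc
    obtain ⟨a, b, hab⟩ := Ideal.mem_span_pair.1 (mem_wittIdeal.1 hc 0)
    obtain ⟨L, hL⟩ : ∃ L, N * p ^ (n + 1) = N + L :=
      Nat.exists_eq_add_of_le (Nat.le_mul_of_pos_right _ (pow_pos (Fact.out : p.Prime).pos _))
    set d := c - teich p (n + 1) (a * x ^ (N * p ^ (n + 1)))
      - teich p (n + 1) (b * y ^ (N * p ^ (n + 1))) with hd
    have hdJ : d ∈ wittIdeal p (n + 1)
        (Ideal.span {x ^ (N * p ^ (n + 1)), y ^ (N * p ^ (n + 1))}) := by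
      refine Ideal.sub_mem _ (Ideal.sub_mem _ hc (teich_mem_wittIdeal ?_)) (teich_mem_wittIdeal ?_)
      · exact Ideal.mul_mem_left _ _ (Ideal.subset_span (by simp))
      · exact Ideal.mul_mem_left _ _ (Ideal.subset_span (by simp))
    have hd0 : d.coeff 0 = 0 := by
      rw [hd, coeff_zero_sub, coeff_zero_sub, coeff_teich, coeff_teich, if_pos (by simp),
        if_pos (by simp), ← hab]
      ring
    have htail : wittTail d ∈ teichIdeal p n x y (p * N) := by
      apply ih
      rw [mem_wittIdeal]
      intro i
      have := mem_wittIdeal.1 hdJ i.succ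
      rw [coeff_wittTail]
      have h1 : p * N * p ^ n = N * p ^ (n + 1) := by ring
      rwa [h1]
    obtain ⟨u, v, huv⟩ := Ideal.mem_span_pair.1 htail
    have hV : d ∈ teichIdeal p (n + 1) x y N := by
      rw [← verschiebung_wittTail d hd0, ← huv, map_add]
      have h1 : ∀ (w : R) (c : TruncatedWittVector p n R),
          verschiebungPow p n.le_succ R (c * teich p n w ^ (p * N)) =
            verschiebungPow p n.le_succ R c * teich p (n + 1) w ^ N := by
        intro w c
        rw [mul_comm (verschiebungPow _ _ _ _), ← map_pow (teich p (n + 1)),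
          teich_mul_verschiebung, mul_comm c, ← map_pow, ← pow_mul, mul_comm N]
      rw [h1, h1]
      exact Ideal.mem_span_pair.2 ⟨_, _, rfl⟩
    have hc' : c = d + (teich p (n + 1) (a * x ^ L) * teich p (n + 1) x ^ N +
        teich p (n + 1) (b * y ^ L) * teich p (n + 1) y ^ N) := by
      rw [hd, hL]
      simp only [map_mul, map_pow, pow_add]
      ring
    rw [hc']
    exact Ideal.add_mem _ hV (Ideal.mem_span_pair.2 ⟨_, _, rfl⟩)

/-- If a power of `y` lies in `(x, t)`, then `[y]` is nilpotent modulo each `([x] ^ N, [t] ^ N)`. -/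
theorem exists_teich_pow_mem (x t y : R) (h : y ∈ (Ideal.span {x, t}).radical) (N : ℕ) :
    ∃ K, teich p n y ^ K ∈ teichIdeal p n x t N := by
  obtain ⟨K, hK⟩ := h
  set L := N * p ^ n
  have h2 : y ^ (K * (L + L)) ∈ Ideal.span {x ^ L, t ^ L} := by
    rw [pow_mul y]
    obtain ⟨a, b, hab⟩ := Ideal.mem_span_pair.1 hK
    rw [← hab]
    apply Ideal.add_pow_mem_of_pow_mem_of_le (m := L) (n := L) _ _ _ (by omega)
    · rw [mul_pow]
      exact Ideal.mul_mem_left _ _ (Ideal.subset_span (by simp))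
    · rw [mul_pow]
      exact Ideal.mul_mem_left _ _ (Ideal.subset_span (by simp))
  refine ⟨K * (L + L), wittIdeal_le_teichIdeal x t N ?_⟩
  rw [← map_pow]
  exact teich_mem_wittIdeal h2

end

end WittLC

/-! ### Fractions and Čech coboundaries -/

namespace WittLC

section

variable {p : ℕ} [Fact p.Prime] {n : ℕ} {A : Type*} [CommRing A]

/-- Every element of `W_n(A[1/s])` becomes integral after multiplication with a power of `[s]`. -/
theorem exists_teich_pow_mul_eq (s : A) (u : TruncatedWittVector p n (Localization.Away s)) :
    ∃ (N : ℕ) (b : TruncatedWittVector p n A),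
      teich p n (algebraMap A _ s) ^ N * u = wittMap p n (algebraMap A _) b := by
  choose N a ha using fun i => IsLocalization.Away.surj s (u.coeff i)
  have hle : ∀ i, N i ≤ (∑ j, N j) * p ^ i.1 := fun i =>
    (Finset.single_le_sum (fun j _ => Nat.zero_le (N j)) (Finset.mem_univ i)).trans
      (Nat.le_mul_of_pos_right _ (pow_pos (Fact.out : p.Prime).pos _))
  refine ⟨∑ j, N j, TruncatedWittVector.mk p fun i => s ^ ((∑ j, N j) * p ^ i.1 - N i) * a i, ?_⟩
  ext i
  rw [← map_pow (teich p n), coeff_teich_mul, coeff_wittMap, TruncatedWittVector.coeff_mk, map_mul,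
    ← ha, map_pow, ← pow_mul, mul_left_comm, ← pow_add, Nat.sub_add_cancel (hle i), mul_comm]

theorem exists_teich_pow_mul_eq_zero (s : A) (b : TruncatedWittVector p n A)
    (hb : wittMap p n (algebraMap A (Localization.Away s)) b = 0) :
    ∃ M : ℕ, teich p n s ^ M * b = 0 := by
  have h : ∀ i, ∃ M : ℕ, s ^ M * b.coeff i = 0 := by
    intro i
    obtain ⟨⟨_, M, rfl⟩, hM⟩ := (IsLocalization.map_eq_zero_iff (Submonoid.powers s)
      (Localization.Away s) (b.coeff i)).1 ((wittMap_eq_zero_iff _ _).1 hb i)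
    exact ⟨M, hM⟩
  choose M hM using h
  have hle : ∀ i, M i ≤ (∑ j, M j) * p ^ i.1 := fun i =>
    (Finset.single_le_sum (fun j _ => Nat.zero_le (M j)) (Finset.mem_univ i)).trans
      (Nat.le_mul_of_pos_right _ (pow_pos (Fact.out : p.Prime).pos _))
  refine ⟨∑ j, M j, ?_⟩
  ext i
  rw [← map_pow (teich p n), coeff_teich_mul, ← pow_mul, TruncatedWittVector.coeff_zero,
    ← Nat.sub_add_cancel (hle i), pow_add, mul_assoc, hM, mul_zero]

/-- The fraction `b / [xy] ^ N` in `W_n(A[1/(xy)])`. -/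
def frac (x y : A) (b : TruncatedWittVector p n A) (N : ℕ) :
    TruncatedWittVector p n (Localization.Away (x * y)) :=
  wittMap p n (algebraMap A _) b * teich p n (IsLocalization.Away.invSelf (x * y)) ^ N

theorem teich_mul_teich_invSelf (s : A) :
    teich p n (algebraMap A (Localization.Away s) s) *
      teich p n (IsLocalization.Away.invSelf s) = 1 := by
  rw [← map_mul, IsLocalization.Away.mul_invSelf, map_one]

theorem teich_pow_mul_teich_invSelf_pow (s : A) (N : ℕ) :
    teich p n (algebraMap A (Localization.Away s) s) ^ N *
      teich p n (IsLocalization.Away.invSelf s) ^ N = 1 := by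
  rw [← mul_pow, teich_mul_teich_invSelf, one_pow]

theorem frac_teich_pow_mul (x y : A) (b : TruncatedWittVector p n A) (N K : ℕ) :
    frac x y (teich p n (x * y) ^ K * b) (N + K) = frac x y b N := by
  rw [frac, frac, map_mul, map_pow, wittMap_teich]
  linear_combination (wittMap p n (algebraMap A (Localization.Away (x * y))) b *
    teich p n (IsLocalization.Away.invSelf (x * y)) ^ N) *
    teich_pow_mul_teich_invSelf_pow (p := p) (n := n) (x * y) K

theorem frac_sub (x y : A) (b b' : TruncatedWittVector p n A) (N : ℕ) :
    frac x y (b - b') N = frac x y b N - frac x y b' N := by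
  rw [frac, frac, frac, map_sub, sub_mul]

theorem smul_frac (x y : A) (c b : TruncatedWittVector p n A) (N : ℕ) :
    c • frac x y b N = frac x y (c * b) N := by
  rw [frac, frac, map_mul, mul_assoc]
  rfl

theorem exists_eq_frac (x y : A) (u : TruncatedWittVector p n (Localization.Away (x * y))) :
    ∃ b N, u = frac x y b N := by
  obtain ⟨N, b, hb⟩ := exists_teich_pow_mul_eq (x * y) u
  refine ⟨b, N, ?_⟩
  rw [frac, ← hb]
  linear_combination (-u) * teich_pow_mul_teich_invSelf_pow (p := p) (n := n) (x * y) N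

theorem wittMap_locLeft_algebraMap (x y : A) (c : TruncatedWittVector p n A) :
    wittMap p n (locLeft x y) (wittMap p n (algebraMap A (Localization.Away x)) c) =
      wittMap p n (algebraMap A (Localization.Away (x * y))) c := by
  rw [wittMap_comp]
  congr 2
  exact RingHom.ext fun a => IsLocalization.Away.awayToAwayRight_eq x y a

theorem wittMap_locRight_algebraMap (x y : A) (c : TruncatedWittVector p n A) :
    wittMap p n (locRight x y) (wittMap p n (algebraMap A (Localization.Away y)) c) =
      wittMap p n (algebraMap A (Localization.Away (x * y))) c := by
  rw [wittMap_comp]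
  congr 2
  exact RingHom.ext fun a => IsLocalization.Away.awayToAwayLeft_eq y x a

/-- The fractions `b / [x] ^ N` and `b / [y] ^ N` are coboundaries. -/
theorem frac_mem_cechBoundary_of_mem_teichIdeal (x y : A) (b : TruncatedWittVector p n A) (N : ℕ)
    (hb : b ∈ teichIdeal p n x y N) : frac x y b N ∈ cechBoundary p n x y := by
  obtain ⟨c, d, rfl⟩ := Ideal.mem_span_pair.1 hb
  have e := teich_pow_mul_teich_invSelf_pow (p := p) (n := n) (x * y) N
  rw [map_mul, map_mul, mul_pow] at e
  refine ⟨wittMap p n (algebraMap A _) d * teich p n (IsLocalization.Away.invSelf x) ^ N,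
    wittMap p n (algebraMap A _) c * teich p n (IsLocalization.Away.invSelf y) ^ N, ?_⟩
  have hx := congrArg (wittMap p n (locLeft x y))
    (teich_pow_mul_teich_invSelf_pow (p := p) (n := n) x N)
  have hy := congrArg (wittMap p n (locRight x y))
    (teich_pow_mul_teich_invSelf_pow (p := p) (n := n) y N)
  rw [← wittMap_teich (algebraMap A (Localization.Away x)), map_mul, map_pow,
    wittMap_locLeft_algebraMap, wittMap_teich, map_one] at hx
  rw [← wittMap_teich (algebraMap A (Localization.Away y)), map_mul, map_pow,
    wittMap_locRight_algebraMap, wittMap_teich, map_one] at hy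
  rw [frac, map_add, map_mul, map_mul, map_mul, map_mul, wittMap_locLeft_algebraMap,
    wittMap_locRight_algebraMap, map_pow, map_pow, wittMap_teich, wittMap_teich]
  set X := teich p n (algebraMap A (Localization.Away (x * y)) x) ^ N
  set Y := teich p n (algebraMap A (Localization.Away (x * y)) y) ^ N
  set I := teich p n (IsLocalization.Away.invSelf (S := Localization.Away (x * y)) (x * y)) ^ N
  set D := wittMap p n (algebraMap A (Localization.Away (x * y))) d
  set C := wittMap p n (algebraMap A (Localization.Away (x * y))) c
  set U := wittMap p n (locLeft x y) (teich p n (IsLocalization.Away.invSelf x) ^ N)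
  set V := wittMap p n (locRight x y) (teich p n (IsLocalization.Away.invSelf y) ^ N)
  -- with `hx : X * U = 1`, `hy : Y * V = 1`, `e : X * Y * I = 1`
  linear_combination (C * V + D * U) * e - D * Y * I * hx - C * X * I * hy

/-- The fraction `b / [xy] ^ N` is a coboundary if and only if `[xy] ^ M b` lies in
`([x] ^ (N + M), [y] ^ (N + M))` for some `M`. -/
theorem frac_mem_cechBoundary_iff (x y : A) (b : TruncatedWittVector p n A) (N : ℕ) :
    frac x y b N ∈ cechBoundary p n x y ↔
      ∃ M, teich p n (x * y) ^ M * b ∈ teichIdeal p n x y (N + M) := by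
  constructor
  · rintro ⟨a, a', h⟩
    obtain ⟨L₁, α, hα⟩ := exists_teich_pow_mul_eq x a
    obtain ⟨L₂, β, hβ⟩ := exists_teich_pow_mul_eq y a'
    replace hα := congrArg (wittMap p n (locLeft x y)) hα
    replace hβ := congrArg (wittMap p n (locRight x y)) hβ
    rw [← wittMap_teich (algebraMap A (Localization.Away x)), map_mul, map_pow,
      wittMap_locLeft_algebraMap, wittMap_locLeft_algebraMap, wittMap_teich] at hα
    rw [← wittMap_teich (algebraMap A (Localization.Away y)), map_mul, map_pow,
      wittMap_locRight_algebraMap, wittMap_locRight_algebraMap, wittMap_teich] at hβ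
    have e := teich_pow_mul_teich_invSelf_pow (p := p) (n := n) (x * y) N
    have key : wittMap p n (algebraMap A (Localization.Away (x * y)))
        (teich p n (x * y) ^ (L₁ + L₂) * b -
          (teich p n x ^ (N + L₂) * teich p n y ^ (N + L₁ + L₂) * α +
            teich p n y ^ (N + L₁) * teich p n x ^ (N + L₁ + L₂) * β)) = 0 := by
      simp only [frac, map_sub, map_add, map_mul, map_pow, wittMap_teich] at h e ⊢
      rw [← hα, ← hβ]
      linear_combination (teich p n (algebraMap A (Localization.Away (x * y)) x) *
        teich p n (algebraMap A (Localization.Away (x * y)) y)) ^ (N + L₁ + L₂) * h -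
        (teich p n (algebraMap A (Localization.Away (x * y)) x) *
        teich p n (algebraMap A (Localization.Away (x * y)) y)) ^ (L₁ + L₂) *
          wittMap p n (algebraMap A (Localization.Away (x * y))) b * e
    obtain ⟨K, hK⟩ := exists_teich_pow_mul_eq_zero _ _ key
    refine ⟨L₁ + L₂ + K, Ideal.mem_span_pair.2
      ⟨teich p n y ^ (N + L₁ + K) * β, teich p n x ^ (N + L₂ + K) * α, ?_⟩⟩
    rw [map_mul] at hK ⊢
    linear_combination -hK
  · rintro ⟨M, hM⟩
    rw [← frac_teich_pow_mul x y b N M]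
    exact frac_mem_cechBoundary_of_mem_teichIdeal x y _ _ hM

end

end WittLC

/-! ### Isomorphisms of local cohomology groups -/

namespace WittLC

section

variable {p : ℕ} [Fact p.Prime] {A : Type*} [CommRing A] {x y : A} {I : Ideal A}

theorem LocCoh.mem_torsion_iff {n : ℕ} (hn : 1 ≤ n) (h : LocCoh p n x y) :
    h ∈ LocCoh.torsion p hn x y I ↔
      ∀ c : TruncatedWittVector p n A, c.coeff ⟨0, hn⟩ ∈ I → c • h = 0 := by
  rw [LocCoh.torsion, Submodule.mem_torsionBySet_iff]
  exact ⟨fun h c hc => h ⟨c, hc⟩, fun h c => h c.1 c.2⟩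

theorem LocCoh.R_mk {m n : ℕ} (h : m ≤ n)
    (u : TruncatedWittVector p n (Localization.Away (x * y))) :
    LocCoh.R p h x y (Submodule.Quotient.mk u) =
      Submodule.Quotient.mk (TruncatedWittVector.truncate h u) := rfl

theorem LocCoh.V_mk {m n : ℕ} (h : m ≤ n)
    (u : TruncatedWittVector p m (Localization.Away (x * y))) :
    LocCoh.V p h x y (Submodule.Quotient.mk u) =
      Submodule.Quotient.mk (verschiebungPow p h _ u) := rfl

theorem wittMap_id {n : ℕ} (c : TruncatedWittVector p n A) : wittMap p n (RingHom.id A) c = c := rfl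

theorem teichIdeal_comm (x y : A) (n N : ℕ) : teichIdeal p n x y N = teichIdeal p n y x N := by
  rw [teichIdeal, teichIdeal, Set.pair_comm]

end

/-- Isomorphisms `H²(W_n(A)) ≃ H²(W_n(A'))` for all `n`, where the left side is computed by `x, y`
and the right side by `x', y'`, that are compatible with `F`, `R`, `V`, with the `I`- and
`I'`-torsion parts, and with generators of these for `n = 1`. -/
structure LocCohIso (p : ℕ) [Fact p.Prime] {A A' : Type*} [CommRing A] [CommRing A']
    [CharP A p] [CharP A' p] (x y : A) (I : Ideal A) (x' y' : A') (I' : Ideal A') where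
  /-- The underlying isomorphism for Witt vectors of length `n`. -/
  equiv : ∀ n, LocCoh p n x y ≃+ LocCoh p n x' y'
  map_F : ∀ n h, equiv n (LocCoh.F p n x y h) = LocCoh.F p n x' y' (equiv n h)
  map_R : ∀ {m n} (hmn : m ≤ n) h, equiv m (LocCoh.R p hmn x y h) =
    LocCoh.R p hmn x' y' (equiv n h)
  map_V : ∀ {m n} (hmn : m ≤ n) h, equiv n (LocCoh.V p hmn x y h) =
    LocCoh.V p hmn x' y' (equiv m h)
  mem_torsion : ∀ {n} (hn : 1 ≤ n) h, equiv n h ∈ LocCoh.torsion p hn x' y' I' ↔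
    h ∈ LocCoh.torsion p hn x y I
  isGenerator : ∀ g, LocCoh.IsGenerator I' (equiv 1 g) ↔ LocCoh.IsGenerator I g

/-- There is a class `e` in the `I`-torsion of `H²(W_n(A))` that lifts a generator of the
`I`-torsion of `H²(A)`, with `F e = 0` if `P` holds, and with `F e = V^{n-1} e'` for a generator
`e'` if `Q` holds. -/
def HasFrobeniusClass (p : ℕ) [Fact p.Prime] {n : ℕ} (hn : 1 ≤ n) {A : Type*} [CommRing A]
    [CharP A p] (x y : A) (I : Ideal A) (P Q : Prop) : Prop :=
  ∃ e ∈ LocCoh.torsion p hn x y I,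
    LocCoh.IsGenerator I (LocCoh.R p hn x y e) ∧
    (P → LocCoh.F p n x y e = 0) ∧
    (Q → ∃ e' ∈ LocCoh.torsion p le_rfl x y I, LocCoh.IsGenerator I e' ∧
      LocCoh.F p n x y e = LocCoh.V p hn x y e')

section

variable {p : ℕ} [Fact p.Prime] {A A' A'' : Type*} [CommRing A] [CommRing A'] [CommRing A'']
  [CharP A p] [CharP A' p] [CharP A'' p] {x y : A} {I : Ideal A} {x' y' : A'} {I' : Ideal A'}
  {x'' y'' : A''} {I'' : Ideal A''}

/-- The inverse of a `LocCohIso`. -/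
def LocCohIso.symm (Φ : LocCohIso p x y I x' y' I') : LocCohIso p x' y' I' x y I where
  equiv n := (Φ.equiv n).symm
  map_F n h := by
    rw [AddEquiv.symm_apply_eq, Φ.map_F, AddEquiv.apply_symm_apply]
  map_R hmn h := by
    rw [AddEquiv.symm_apply_eq, Φ.map_R, AddEquiv.apply_symm_apply]
  map_V hmn h := by
    rw [AddEquiv.symm_apply_eq, Φ.map_V, AddEquiv.apply_symm_apply]
  mem_torsion hn h := by
    rw [← Φ.mem_torsion, AddEquiv.apply_symm_apply]
  isGenerator g := by
    rw [← Φ.isGenerator, AddEquiv.apply_symm_apply]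

/-- The composition of two `LocCohIso`s. -/
def LocCohIso.trans (Φ : LocCohIso p x y I x' y' I') (Ψ : LocCohIso p x' y' I' x'' y'' I'') :
    LocCohIso p x y I x'' y'' I'' where
  equiv n := (Φ.equiv n).trans (Ψ.equiv n)
  map_F n h := by
    rw [AddEquiv.trans_apply, AddEquiv.trans_apply, Φ.map_F, Ψ.map_F]
  map_R hmn h := by
    rw [AddEquiv.trans_apply, AddEquiv.trans_apply, Φ.map_R, Ψ.map_R]
  map_V hmn h := by
    rw [AddEquiv.trans_apply, AddEquiv.trans_apply, Φ.map_V, Ψ.map_V]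
  mem_torsion hn h := by
    rw [AddEquiv.trans_apply, Ψ.mem_torsion, Φ.mem_torsion]
  isGenerator g := by
    rw [AddEquiv.trans_apply, Ψ.isGenerator, Φ.isGenerator]

theorem HasFrobeniusClass.of_iso (Φ : LocCohIso p x y I x' y' I') {n : ℕ} {hn : 1 ≤ n}
    {P Q : Prop} (h : HasFrobeniusClass p hn x y I P Q) :
    HasFrobeniusClass p hn x' y' I' P Q := by
  obtain ⟨e, he, hgen, hP, hQ⟩ := h
  refine ⟨Φ.equiv n e, (Φ.mem_torsion hn e).2 he, ?_, fun h => ?_, fun h => ?_⟩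
  · rw [← Φ.map_R]
    exact (Φ.isGenerator _).2 hgen
  · rw [← Φ.map_F, hP h, map_zero]
  · obtain ⟨e', he', hgen', heq⟩ := hQ h
    exact ⟨Φ.equiv 1 e', (Φ.mem_torsion _ e').2 he', (Φ.isGenerator _).2 hgen', by
      rw [← Φ.map_F, heq, Φ.map_V]⟩

theorem LocCoh.F_mk {n : ℕ} (u : TruncatedWittVector p n (Localization.Away (x * y))) :
    LocCoh.F p n x y (Submodule.Quotient.mk u) = Submodule.Quotient.mk
      (wittMap p n (frob p (natCast_localization_eq_zero p (Submonoid.powers (x * y)))) u) := rfl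

/-- A ring homomorphism `f : A → A'` and an element `s` with `x' y' = f (x y) s` induce
isomorphisms of local cohomology groups, if the map `b / [xy] ^ N ↦ f(b) [s] ^ N / [x'y'] ^ N` is
injective and surjective modulo coboundaries, and if elements of `W_n(A')` act on each class like
elements of `W_n(A)`. -/
theorem nonempty_locCohIso (f : A →+* A') (s : A') (hs : x' * y' = f (x * y) * s)
    (h0 : ∀ (n : ℕ) (b : TruncatedWittVector p n A) (N : ℕ), frac x y b N ∈ cechBoundary p n x y ↔
      frac x' y' (wittMap p n f b * teich p n s ^ N) N ∈ cechBoundary p n x' y')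
    (hsurj : ∀ (n : ℕ) (b' : TruncatedWittVector p n A') (N' : ℕ), ∃ b N,
      frac x' y' b' N' - frac x' y' (wittMap p n f b * teich p n s ^ N) N ∈
        cechBoundary p n x' y')
    (hI : ∀ a, f a ∈ I' ↔ a ∈ I)
    (happ : ∀ (n : ℕ) (c' b' : TruncatedWittVector p n A') (N : ℕ), ∃ c,
      c' - wittMap p n f c ∈ wittIdeal p n I' ∧
        frac x' y' ((c' - wittMap p n f c) * b') N ∈ cechBoundary p n x' y') :
    Nonempty (LocCohIso p x y I x' y' I') := by
  set B := Localization.Away (x * y)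
  set B' := Localization.Away (x' * y')
  have hinv : algebraMap A' B' (f (x * y)) *
      (algebraMap A' B' s * IsLocalization.Away.invSelf (x' * y')) = 1 := by
    rw [← mul_assoc, ← map_mul, ← hs, IsLocalization.Away.mul_invSelf]
  have hunit : IsUnit (((algebraMap A' B').comp f) (x * y)) := IsUnit.of_mul_eq_one _ hinv
  set g : B →+* B' := IsLocalization.Away.lift (x * y) hunit with hg
  have hgf : ∀ a, g (algebraMap A B a) = algebraMap A' B' (f a) := fun a =>
    IsLocalization.Away.lift_eq (x * y) hunit a
  have hginv : g (IsLocalization.Away.invSelf (x * y)) =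
      algebraMap A' B' s * IsLocalization.Away.invSelf (x' * y') := by
    have h1 := congrArg g (IsLocalization.Away.mul_invSelf (S := B) (x * y))
    rw [map_mul, hgf, map_one] at h1
    linear_combination (algebraMap A' B' s * IsLocalization.Away.invSelf (x' * y')) * h1 -
      g (IsLocalization.Away.invSelf (x * y)) * hinv
  have hgW : ∀ (n : ℕ) (c : TruncatedWittVector p n A),
      wittMap p n g (wittMap p n (algebraMap A B) c) =
      wittMap p n (algebraMap A' B') (wittMap p n f c) := by
    intro n c
    rw [wittMap_comp, wittMap_comp]
    congr 2
    exact RingHom.ext hgf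
  have hfrac : ∀ (n : ℕ) (b : TruncatedWittVector p n A) (N : ℕ), wittMap p n g (frac x y b N) =
      frac x' y' (wittMap p n f b * teich p n s ^ N) N := by
    intro n b N
    rw [frac, frac, map_mul, map_pow, hgW, wittMap_teich, hginv, map_mul, map_mul, map_pow,
      wittMap_teich, mul_pow, mul_assoc]
  have hmem : ∀ (n : ℕ) (u : TruncatedWittVector p n B), u ∈ cechBoundary p n x y ↔
      wittMap p n g u ∈ cechBoundary p n x' y' := by
    intro n u
    obtain ⟨b, N, rfl⟩ := exists_eq_frac x y u
    rw [hfrac]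
    exact h0 n b N
  let φ : ∀ n, LocCoh p n x y →+ LocCoh p n x' y' := fun n =>
    QuotientAddGroup.map (cechBoundary p n x y).toAddSubgroup (cechBoundary p n x' y').toAddSubgroup
      (wittMap p n g).toAddMonoidHom fun u hu => (hmem n u).1 hu
  have hφ : ∀ n u, φ n (Submodule.Quotient.mk u) = Submodule.Quotient.mk (wittMap p n g u) :=
    fun n u => rfl
  have hbij : ∀ n, Function.Bijective (φ n) := by
    intro n
    constructor
    · rw [injective_iff_map_eq_zero]
      intro h hh
      obtain ⟨u, rfl⟩ := Submodule.Quotient.mk_surjective _ h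
      rw [hφ, Submodule.Quotient.mk_eq_zero] at hh
      rw [Submodule.Quotient.mk_eq_zero]
      exact (hmem n u).2 hh
    · intro h
      obtain ⟨u, rfl⟩ := Submodule.Quotient.mk_surjective _ h
      obtain ⟨b', N', rfl⟩ := exists_eq_frac x' y' u
      obtain ⟨b, N, hb⟩ := hsurj n b' N'
      refine ⟨Submodule.Quotient.mk (frac x y b N), ?_⟩
      rw [hφ, hfrac]
      exact ((Submodule.Quotient.eq _).2 hb).symm
  have hsmul : ∀ n (c : TruncatedWittVector p n A) h, φ n (c • h) = wittMap p n f c • φ n h := by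
    intro n c h
    obtain ⟨u, rfl⟩ := Submodule.Quotient.mk_surjective _ h
    rw [← Submodule.Quotient.mk_smul, hφ, hφ, ← Submodule.Quotient.mk_smul]
    congr 1
    change wittMap p n g (wittMap p n (algebraMap A B) c * u) =
      wittMap p n (algebraMap A' B') (wittMap p n f c) * wittMap p n g u
    rw [map_mul, hgW]
  have happ' : ∀ n (c' : TruncatedWittVector p n A') (h : LocCoh p n x' y'), ∃ c,
      c' - wittMap p n f c ∈ wittIdeal p n I' ∧ c' • h = wittMap p n f c • h := by
    intro n c' h
    obtain ⟨u, rfl⟩ := Submodule.Quotient.mk_surjective _ h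
    obtain ⟨b', N', rfl⟩ := exists_eq_frac x' y' u
    obtain ⟨c, hc, hc'⟩ := happ n c' b' N'
    refine ⟨c, hc, ?_⟩
    rw [← sub_eq_zero, ← sub_smul, ← Submodule.Quotient.mk_smul, Submodule.Quotient.mk_eq_zero,
      smul_frac]
    exact hc'
  have htors : ∀ {n} (hn : 1 ≤ n) h, φ n h ∈ LocCoh.torsion p hn x' y' I' ↔
      h ∈ LocCoh.torsion p hn x y I := by
    intro n hn h
    rw [LocCoh.mem_torsion_iff, LocCoh.mem_torsion_iff]
    constructor
    · intro H c hc
      apply (hbij n).1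
      rw [hsmul, map_zero]
      exact H _ ((hI _).2 hc)
    · intro H c' hc'
      obtain ⟨c, hc, heq⟩ := happ' n c' (φ n h)
      rw [heq, ← hsmul, H c, map_zero]
      obtain ⟨n, rfl⟩ : ∃ m, n = m + 1 := ⟨n - 1, by omega⟩
      have h1 := mem_wittIdeal.1 hc 0
      rw [coeff_zero_sub] at h1
      exact (hI _).1 ((Submodule.sub_mem_iff_right I' hc').1 h1)
  refine ⟨⟨fun n => AddEquiv.ofBijective (φ n) (hbij n), ?_, ?_, ?_, fun hn h => htors hn h, ?_⟩⟩
  · intro n h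
    obtain ⟨u, rfl⟩ := Submodule.Quotient.mk_surjective _ h
    rw [LocCoh.F_mk, AddEquiv.ofBijective_apply, AddEquiv.ofBijective_apply, hφ, hφ, LocCoh.F_mk,
      wittMap_comp, wittMap_comp, frob_naturality]
  · intro m n hmn h
    obtain ⟨u, rfl⟩ := Submodule.Quotient.mk_surjective _ h
    rw [LocCoh.R_mk, AddEquiv.ofBijective_apply, AddEquiv.ofBijective_apply, hφ, hφ, LocCoh.R_mk,
      wittMap_truncate]
  · intro m n hmn h
    obtain ⟨u, rfl⟩ := Submodule.Quotient.mk_surjective _ h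
    rw [LocCoh.V_mk, AddEquiv.ofBijective_apply, AddEquiv.ofBijective_apply, hφ, hφ, LocCoh.V_mk,
      wittMap_verschiebungPow]
  · intro h
    rw [AddEquiv.ofBijective_apply]
    constructor
    · intro H
      refine le_antisymm ?_ fun t ht => ?_
      · rw [Submodule.span_singleton_le_iff_mem, ← htors, ← H]
        exact Submodule.mem_span_singleton_self _
      · rw [← htors, ← H, Submodule.mem_span_singleton] at ht
        obtain ⟨c', hc'⟩ := ht
        obtain ⟨c, -, heq⟩ := happ' 1 c' (φ 1 h)
        refine Submodule.mem_span_singleton.2 ⟨c, (hbij 1).1 ?_⟩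
        rw [hsmul, ← heq, hc']
    · intro H
      refine le_antisymm ?_ fun t ht => ?_
      · rw [Submodule.span_singleton_le_iff_mem, htors, ← H]
        exact Submodule.mem_span_singleton_self _
      · obtain ⟨t, rfl⟩ := (hbij 1).2 t
        rw [htors, ← H, Submodule.mem_span_singleton] at ht
        obtain ⟨c, rfl⟩ := ht
        exact Submodule.mem_span_singleton.2 ⟨wittMap p 1 f c, (hsmul 1 c h).symm⟩

/-- The local cohomology groups do not depend on the order of the two elements. -/
theorem nonempty_locCohIso_swap (x y : A) (I : Ideal A) :
    Nonempty (LocCohIso p x y I y x I) := by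
  refine nonempty_locCohIso (RingHom.id A) 1 ?_ (fun n b N => ?_) (fun n b N => ⟨b, N, ?_⟩)
    (fun a => Iff.rfl) fun n c b N => ⟨c, ?_, ?_⟩
  · rw [RingHom.id_apply, mul_one, mul_comm]
  · rw [wittMap_id, map_one, one_pow, mul_one, frac_mem_cechBoundary_iff, frac_mem_cechBoundary_iff,
      mul_comm y x]
    simp only [teichIdeal_comm x y]
  · rw [wittMap_id, map_one, one_pow, mul_one, sub_self]
    exact Submodule.zero_mem _
  · rw [wittMap_id, sub_self]
    exact Ideal.zero_mem _
  · rw [wittMap_id, sub_self, zero_mul, frac, map_zero, zero_mul]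
    exact Submodule.zero_mem _

/-- Replacing `y` by a multiple `y t`, that is, passing to a smaller covering of the punctured
spectrum, does not change the local cohomology groups. -/
theorem nonempty_locCohIso_mul_right (x y t : A) (I : Ideal A)
    (h : y ∈ (Ideal.span {x, t}).radical) :
    Nonempty (LocCohIso p x y I x (y * t) I) := by
  refine nonempty_locCohIso (RingHom.id A) t ?_ (fun n b N => ?_) (fun n b N => ?_)
    (fun a => Iff.rfl) fun n c b N => ⟨c, ?_, ?_⟩
  · rw [RingHom.id_apply, mul_assoc]
  · rw [wittMap_id, frac_mem_cechBoundary_iff, frac_mem_cechBoundary_iff]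
    constructor
    · rintro ⟨M, hM⟩
      obtain ⟨α, β, h1⟩ := Ideal.mem_span_pair.1 hM
      refine ⟨M, Ideal.mem_span_pair.2 ⟨teich p n t ^ (N + M) * α, β, ?_⟩⟩
      simp only [map_mul, mul_pow] at h1 ⊢
      linear_combination teich p n t ^ (N + M) * h1
    · rintro ⟨M, hM⟩
      obtain ⟨α, β, h1⟩ := Ideal.mem_span_pair.1 hM
      obtain ⟨K, hK⟩ := exists_teich_pow_mem (p := p) (n := n) x t y h (N + M)
      obtain ⟨γ, δ, h2⟩ := Ideal.mem_span_pair.1 hK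
      refine ⟨M + K, Ideal.mem_span_pair.2 ⟨teich p n y ^ M * γ *
        (teich p n x ^ M * b - β * teich p n y ^ N) + δ * α, β * teich p n x ^ K, ?_⟩⟩
      simp only [map_mul, mul_pow] at h1 ⊢
      linear_combination teich p n x ^ K * (δ * h1 + teich p n y ^ M * (teich p n x ^ M * b -
        β * teich p n y ^ N) * h2)
  · obtain ⟨K, hK⟩ := exists_teich_pow_mem (p := p) (n := n) x t y h N
    obtain ⟨γ, δ, h2⟩ := Ideal.mem_span_pair.1 hK
    refine ⟨δ * b * teich p n x ^ K, N + K, ?_⟩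
    rw [wittMap_id, ← frac_teich_pow_mul x (y * t) b N K, ← frac_sub]
    apply frac_mem_cechBoundary_of_mem_teichIdeal
    refine Ideal.mem_span_pair.2 ⟨γ * teich p n t ^ K * b, 0, ?_⟩
    simp only [map_mul, mul_pow]
    linear_combination teich p n x ^ K * teich p n t ^ K * b * h2
  · rw [wittMap_id, sub_self]
    exact Ideal.zero_mem _
  · rw [wittMap_id, sub_self, zero_mul, frac, map_zero, zero_mul]
    exact Submodule.zero_mem _

/-- Two pairs with a common first element that generate the same radical ideal compute the same
local cohomology groups. -/
theorem nonempty_locCohIso_of_mem_radical (x y t : A) (I : Ideal A)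
    (h : y ∈ (Ideal.span {x, t}).radical) (h' : t ∈ (Ideal.span {x, y}).radical) :
    Nonempty (LocCohIso p x y I x t I) := by
  obtain ⟨Φ⟩ := nonempty_locCohIso_mul_right (p := p) x y t I h
  obtain ⟨Ψ⟩ := nonempty_locCohIso_mul_right (p := p) x t y I h'
  rw [mul_comm t y] at Ψ
  exact ⟨Φ.trans Ψ.symm⟩

/-- If `f : A → A'` induces isomorphisms modulo the powers `(x ^ N, y ^ N)`, then it induces
isomorphisms of local cohomology groups. -/
theorem nonempty_locCohIso_of_dense (f : A →+* A') (x y : A)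
    (hsurj : ∀ (N : ℕ) (a' : A'), ∃ a, a' - f a ∈ Ideal.span {f x ^ N, f y ^ N})
    (hinj : ∀ (N : ℕ) (a : A), f a ∈ Ideal.span {f x ^ N, f y ^ N} → a ∈ Ideal.span {x ^ N, y ^ N})
    (hI : ∀ a, f a ∈ I' ↔ a ∈ I) (hx : x ∈ I) (hy : y ∈ I) :
    Nonempty (LocCohIso p x y I (f x) (f y) I') := by
  have happ : ∀ (n : ℕ) (c' : TruncatedWittVector p n A') (N : ℕ), ∃ c,
      c' - wittMap p n f c ∈ wittIdeal p n (Ideal.span {f x ^ N, f y ^ N}) := by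
    intro n c' N
    choose a ha using fun i => hsurj N (c'.coeff i)
    refine ⟨TruncatedWittVector.mk p a, ?_⟩
    rw [wittIdeal, RingHom.mem_ker, map_sub, sub_eq_zero]
    ext i
    rw [coeff_wittMap, coeff_wittMap, coeff_wittMap, TruncatedWittVector.coeff_mk]
    exact (Ideal.Quotient.mk_eq_mk_iff_sub_mem _ _).2 (ha i)
  refine nonempty_locCohIso f 1 ?_ (fun n b N => ?_) (fun n b' N => ?_) hI (fun n c' b' N => ?_)
  · rw [map_mul, mul_one]
  · rw [map_one, one_pow, mul_one, frac_mem_cechBoundary_iff, frac_mem_cechBoundary_iff]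
    constructor
    · rintro ⟨M, hM⟩
      obtain ⟨α, β, h1⟩ := Ideal.mem_span_pair.1 hM
      refine ⟨M, Ideal.mem_span_pair.2 ⟨wittMap p n f α, wittMap p n f β, ?_⟩⟩
      have h2 := congrArg (wittMap p n f) h1
      simpa only [map_mul, map_add, map_pow, wittMap_teich] using h2
    · rintro ⟨M, hM⟩
      obtain ⟨α', β', h1⟩ := Ideal.mem_span_pair.1 hM
      -- approximate the coefficients `α', β'` by elements of `W_n(A)`
      set L := (N + M) * p ^ n
      obtain ⟨α, hα⟩ := happ n α' L
      obtain ⟨β, hβ⟩ := happ n β' L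
      refine ⟨M, ?_⟩
      have h2 : teich p n (x * y) ^ M * b -
          (α * teich p n x ^ (N + M) + β * teich p n y ^ (N + M)) ∈
          wittIdeal p n (Ideal.span {x ^ L, y ^ L}) := by
        rw [mem_wittIdeal]
        intro i
        apply hinj
        rw [← coeff_wittMap]
        refine mem_wittIdeal.1 (?_ : _ ∈ wittIdeal p n (Ideal.span {f x ^ L, f y ^ L})) i
        have h3 := Ideal.add_mem _ (Ideal.mul_mem_right (teich p n (f x) ^ (N + M)) _ hα)
          (Ideal.mul_mem_right (teich p n (f y) ^ (N + M)) _ hβ)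
        convert h3 using 1
        simp only [map_mul, map_add, map_sub, map_pow, wittMap_teich] at h1 ⊢
        linear_combination -h1
      have h3 := Ideal.add_mem _ (wittIdeal_le_teichIdeal x y (N + M) h2)
        (Ideal.mem_span_pair.2 ⟨α, β, rfl⟩ : α * teich p n x ^ (N + M) +
          β * teich p n y ^ (N + M) ∈ teichIdeal p n x y (N + M))
      rwa [sub_add_cancel] at h3
  · obtain ⟨c, hc⟩ := happ n b' (N * p ^ n)
    refine ⟨c, N, ?_⟩
    rw [map_one, one_pow, mul_one, ← frac_sub]
    exact frac_mem_cechBoundary_of_mem_teichIdeal _ _ _ _ (wittIdeal_le_teichIdeal _ _ N hc)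
  · obtain ⟨c, hc⟩ := happ n c' ((N + 1) * p ^ n)
    refine ⟨c, ?_, ?_⟩
    · have hle : Ideal.span {f x ^ ((N + 1) * p ^ n), f y ^ ((N + 1) * p ^ n)} ≤ I' := by
        have hpos : (N + 1) * p ^ n ≠ 0 :=
          Nat.mul_ne_zero N.succ_ne_zero (pow_ne_zero _ (Fact.out : p.Prime).ne_zero)
        rw [Ideal.span_le]
        rintro _ (rfl | rfl)
        · exact Ideal.pow_mem_of_mem _ ((hI x).2 hx) _ (Nat.pos_of_ne_zero hpos)
        · exact Ideal.pow_mem_of_mem _ ((hI y).2 hy) _ (Nat.pos_of_ne_zero hpos)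
      exact mem_wittIdeal.2 fun i => hle (mem_wittIdeal.1 hc i)
    · apply frac_mem_cechBoundary_of_mem_teichIdeal
      obtain ⟨α, β, h1⟩ := Ideal.mem_span_pair.1 (wittIdeal_le_teichIdeal _ _ (N + 1) hc)
      refine Ideal.mem_span_pair.2 ⟨α * teich p n (f x) * b', β * teich p n (f y) * b', ?_⟩
      rw [← h1]
      ring

end

end WittLC

/-! ### Independence of the system of parameters -/

namespace WittLC

open IsLocalRing

theorem span_pair_le_maximalIdeal {B : Type*} [CommRing B] [IsLocalRing B] {x y : B}
    (h : (Ideal.span {x, y}).radical = maximalIdeal B) : x ∈ maximalIdeal B ∧ y ∈ maximalIdeal B :=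
  ⟨h ▸ Ideal.le_radical (Ideal.subset_span (by simp)),
    h ▸ Ideal.le_radical (Ideal.subset_span (by simp))⟩

/-- A prime strictly between a prime `Q` and the maximal ideal does not exist if the maximal ideal
is the radical of `(X, Y)` and `X ∈ Q`, by Krull's principal ideal theorem in the domain `B / Q`. -/
theorem eq_maximalIdeal_of_lt {B : Type*} [CommRing B] [IsLocalRing B] [IsNoetherianRing B]
    {X Y : B} (hXY : (Ideal.span {X, Y}).radical = maximalIdeal B) {P Q : Ideal B} [hP : P.IsPrime]
    [hQ : Q.IsPrime] (hX : X ∈ Q) (hlt : Q < P) : P = maximalIdeal B := by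
  have hYm := (span_pair_le_maximalIdeal hXY).2
  have hmin : maximalIdeal B ∈ (Q ⊔ Ideal.span {Y}).minimalPrimes := by
    refine ⟨⟨inferInstance, sup_le (le_maximalIdeal hQ.ne_top) ?_⟩, fun J hJ _ => ?_⟩
    · rwa [Ideal.span_singleton_le_iff_mem]
    · rw [← hXY, hJ.1.radical_le_iff, Ideal.span_le]
      rintro _ (rfl | rfl)
      · exact hJ.2 (Ideal.mem_sup_left hX)
      · exact hJ.2 (Ideal.mem_sup_right (Ideal.mem_span_singleton_self _))
  have hht := Ideal.map_height_le_one_of_mem_minimalPrimes hmin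
  by_contra hne
  have hmap : ∀ {J : Ideal B}, Q ≤ J →
      (J.map (Ideal.Quotient.mk Q)).comap (Ideal.Quotient.mk Q) = J :=
    fun h => by
      rw [Ideal.comap_map_of_surjective _ Ideal.Quotient.mk_surjective, ← RingHom.ker_eq_comap_bot,
        Ideal.mk_ker, sup_eq_left.2 h]
  have hPp : (P.map (Ideal.Quotient.mk Q)).IsPrime :=
    Ideal.map_isPrime_of_surjective Ideal.Quotient.mk_surjective (by simpa using hlt.le)
  have hlt2 : P.map (Ideal.Quotient.mk Q) < (maximalIdeal B).map (Ideal.Quotient.mk Q) := by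
    refine lt_of_le_of_ne (Ideal.map_mono (le_maximalIdeal hP.ne_top)) fun h => hne ?_
    rw [← hmap hlt.le, h, hmap (le_maximalIdeal hQ.ne_top)]
  have h0 : (P.map (Ideal.Quotient.mk Q)).height = 0 := by
    have h1 := (Ideal.height_strict_mono_of_isPrime hlt2).trans_le hht
    exact Order.lt_one_iff.1 h1
  rw [Ideal.height_eq_zero_iff_eq_bot] at h0
  have h1 := hmap hlt.le
  rw [h0, ← RingHom.ker_eq_comap_bot, Ideal.mk_ker] at h1
  exact hlt.ne h1

/-- Over an infinite field of scalars, a general linear combination of two parameters `x, y`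
completes a given parameter `X` to a system of parameters. -/
theorem exists_linear_parameter (k : Type*) [Field k] [Infinite k] {B : Type*} [CommRing B]
    [IsLocalRing B] [IsNoetherianRing B] [Algebra k B] {x y X Y : B}
    (hxy : (Ideal.span {x, y}).radical = maximalIdeal B)
    (hXY : (Ideal.span {X, Y}).radical = maximalIdeal B) :
    ∃ c : k, (Ideal.span {X, x + algebraMap k B c * y}).radical = maximalIdeal B := by
  obtain ⟨hx, hy⟩ := span_pair_le_maximalIdeal hxy
  set bad : Set k := ⋃ Q ∈ (Ideal.span {X}).minimalPrimes \ {maximalIdeal B},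
    {c | x + algebraMap k B c * y ∈ Q} with hbad
  have hfin : bad.Finite := by
    refine Set.Finite.biUnion ((Ideal.span {X}).finite_minimalPrimes_of_isNoetherianRing B |>.sdiff)
      fun Q hQ => Set.Subsingleton.finite fun c hc d hd => ?_
    have hQp : Q.IsPrime := hQ.1.1.1
    by_contra hcd
    refine hQ.2 (le_antisymm (le_maximalIdeal hQp.ne_top) ?_)
    have hu : IsUnit (algebraMap k B (c - d)) :=
      (IsUnit.mk0 _ (sub_ne_zero.2 hcd)).map (algebraMap k B)
    have h1 : algebraMap k B (c - d) * y ∈ Q := by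
      have := Q.sub_mem hc hd
      rw [map_sub]
      convert this using 1
      ring
    have h2 : y ∈ Q := (Ideal.unit_mul_mem_iff_mem Q hu).1 h1
    have h3 : x ∈ Q := (Submodule.add_mem_iff_left Q (Q.mul_mem_left _ h2)).1 hc
    rw [← hxy, hQp.radical_le_iff, Ideal.span_le]
    rintro _ (rfl | rfl)
    exacts [h3, h2]
  obtain ⟨c, hc⟩ := hfin.exists_notMem
  refine ⟨c, le_antisymm ?_ ?_⟩
  · rw [(maximalIdeal.isMaximal B).isPrime.radical_le_iff, Ideal.span_le]
    rintro _ (rfl | rfl)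
    · exact (span_pair_le_maximalIdeal hXY).1
    · exact Ideal.add_mem _ hx (Ideal.mul_mem_left _ _ hy)
  · rw [Ideal.radical_eq_sInf, le_sInf_iff]
    rintro P ⟨hP, hPp⟩
    have hXP : X ∈ P := hP (Ideal.subset_span (by simp))
    obtain ⟨Q, hQ, hQP⟩ := Ideal.exists_minimalPrimes_le
      ((Ideal.span_singleton_le_iff_mem (I := P)).2 hXP)
    by_cases hQm : Q = maximalIdeal B
    · rwa [← hQm]
    have hQp : Q.IsPrime := hQ.1.1
    have hne : Q ≠ P := by
      rintro rfl
      refine hc (Set.mem_biUnion ⟨hQ, hQm⟩ (hP (Ideal.subset_span (by simp))))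
    exact (eq_maximalIdeal_of_lt hXY (hQ.1.2 (Ideal.mem_span_singleton_self X))
      (lt_of_le_of_ne hQP hne)).ge

/-- Any two systems of parameters compute the same local cohomology groups. -/
theorem nonempty_locCohIso_of_radical_eq (p : ℕ) [Fact p.Prime] (k : Type*) [Field k] [Infinite k]
    {B : Type*} [CommRing B] [IsLocalRing B] [IsNoetherianRing B] [Algebra k B] [CharP B p]
    {x y X Y : B} (hxy : (Ideal.span {x, y}).radical = maximalIdeal B)
    (hXY : (Ideal.span {X, Y}).radical = maximalIdeal B) (I : Ideal B) :
    Nonempty (LocCohIso p x y I X Y I) := by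
  obtain ⟨c, hc⟩ := exists_linear_parameter k hxy hXY
  set w := x + algebraMap k B c * y with hw
  have hwm := (span_pair_le_maximalIdeal hc).2
  obtain ⟨hX, hY⟩ := span_pair_le_maximalIdeal hXY
  obtain ⟨hx, hy⟩ := span_pair_le_maximalIdeal hxy
  have hyw : (Ideal.span {y, w}).radical = maximalIdeal B := by
    rw [← hxy]
    congr 1
    apply le_antisymm <;> rw [Ideal.span_le] <;> rintro _ (rfl | rfl)
    · exact Ideal.subset_span (by simp)
    · exact Ideal.mem_span_pair.2 ⟨1, algebraMap k B c, by rw [hw]; ring⟩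
    · exact Ideal.mem_span_pair.2 ⟨-algebraMap k B c, 1, by rw [hw]; ring⟩
    · exact Ideal.subset_span (by simp)
  have swap : ∀ {a b : B}, (Ideal.span {a, b}).radical = maximalIdeal B →
      (Ideal.span {b, a}).radical = maximalIdeal B := fun h => by rwa [Set.pair_comm]
  have step : ∀ {a b d : B}, (Ideal.span {a, b}).radical = maximalIdeal B →
      (Ideal.span {a, d}).radical = maximalIdeal B → Nonempty (LocCohIso p a b I a d I) :=
    fun h h' => nonempty_locCohIso_of_mem_radical _ _ _ I
      (h' ▸ (span_pair_le_maximalIdeal h).2) (h ▸ (span_pair_le_maximalIdeal h').2)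
  obtain ⟨Φ₁⟩ := nonempty_locCohIso_swap (p := p) x y I
  obtain ⟨Φ₂⟩ := step (swap hxy) hyw
  obtain ⟨Φ₃⟩ := nonempty_locCohIso_swap (p := p) y w I
  obtain ⟨Φ₄⟩ := step (swap hyw) (swap hc)
  obtain ⟨Φ₅⟩ := nonempty_locCohIso_swap (p := p) w X I
  obtain ⟨Φ₆⟩ := step hc hXY
  exact ⟨((((Φ₁.trans Φ₂).trans Φ₃).trans Φ₄).trans Φ₅).trans Φ₆⟩

end WittLC

/-! ### The socle of `H²` of a double cover of the plane -/

namespace WittLC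

open IsLocalRing

/-- The formal properties of a double cover `z ^ 2 = b z + c` of the plane, branched or not, that
determine the socle of its local cohomology: `x, y, z` generate the maximal ideal, `z ^ 2` but not
`z` lies in `(x, y)`, and `y ^ j, x ^ i` are regular sequences. -/
structure IsDoubleCover {B : Type*} [CommRing B] [IsLocalRing B] (x y z : B) : Prop where
  span_eq : Ideal.span {x, y, z} = maximalIdeal B
  sq_mem : z ^ 2 ∈ Ideal.span {x, y}
  notMem : z ∉ Ideal.span {x, y}
  eq_zero_of_mul : ∀ u, y * u = 0 → u = 0
  pow_dvd : ∀ (i j : ℕ) (u v : B), x ^ i * u = y ^ j * v → y ^ j ∣ u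

namespace IsDoubleCover

variable {B : Type*} [CommRing B] [IsLocalRing B] {x y z : B}

theorem mem_left (h : IsDoubleCover x y z) : x ∈ maximalIdeal B :=
  h.span_eq ▸ Ideal.subset_span (by simp)

theorem mem_middle (h : IsDoubleCover x y z) : y ∈ maximalIdeal B :=
  h.span_eq ▸ Ideal.subset_span (by simp)

theorem mem_right (h : IsDoubleCover x y z) : z ∈ maximalIdeal B :=
  h.span_eq ▸ Ideal.subset_span (by simp)

theorem exists_eq (h : IsDoubleCover x y z) {c : B} (hc : c ∈ maximalIdeal B) :
    ∃ α β γ, c = α * x + β * y + γ * z := by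
  rw [← h.span_eq, Ideal.mem_span_insert] at hc
  obtain ⟨α, d, hd, rfl⟩ := hc
  obtain ⟨β, γ, rfl⟩ := Ideal.mem_span_pair.1 hd
  exact ⟨α, β, γ, by ring⟩

theorem radical_eq (h : IsDoubleCover x y z) :
    (Ideal.span {x, y}).radical = maximalIdeal B := by
  apply le_antisymm
  · rw [(maximalIdeal.isMaximal B).isPrime.radical_le_iff, Ideal.span_le]
    rintro _ (rfl | rfl)
    exacts [h.mem_left, h.mem_middle]
  · rw [← h.span_eq, Ideal.span_le]
    rintro _ (rfl | rfl | rfl)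
    · exact Ideal.le_radical (Ideal.subset_span (by simp))
    · exact Ideal.le_radical (Ideal.subset_span (by simp))
    · exact ⟨2, h.sq_mem⟩

theorem unit_mul (h : IsDoubleCover x y z) {c : B} (hc : IsUnit c) :
    IsDoubleCover x y (c * z) where
  span_eq := by
    rw [← h.span_eq]
    obtain ⟨d, hd⟩ := hc.exists_left_inv
    apply le_antisymm <;> rw [Ideal.span_le] <;> rintro _ (rfl | rfl | rfl)
    · exact Ideal.subset_span (by simp)
    · exact Ideal.subset_span (by simp)
    · exact Ideal.mul_mem_left _ _ (Ideal.subset_span (by simp))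
    · exact Ideal.subset_span (by simp)
    · exact Ideal.subset_span (by simp)
    · rename_i z
      have h1 : z = d * (c * z) := by linear_combination (-z) * hd
      rw [h1]
      exact Ideal.mul_mem_left _ _ (Ideal.subset_span (by simp [← h1]))
  sq_mem := by
    rw [mul_pow]
    exact Ideal.mul_mem_left _ _ h.sq_mem
  notMem hmem := h.notMem ((Ideal.unit_mul_mem_iff_mem _ hc).1 hmem)
  eq_zero_of_mul := h.eq_zero_of_mul
  pow_dvd := h.pow_dvd

theorem pow_cancel (h : IsDoubleCover x y z) (j : ℕ) {u v : B} (huv : y ^ j * u = y ^ j * v) :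
    u = v := by
  have key : ∀ (j : ℕ) (w : B), y ^ j * w = 0 → w = 0 := by
    intro j
    induction j with
    | zero => intro w hw; simpa using hw
    | succ j ih =>
      intro w hw
      exact ih w (h.eq_zero_of_mul _ (by rw [← hw]; ring))
  exact sub_eq_zero.1 (key j _ (by rw [mul_sub, huv, sub_self]))

theorem exists_of_pow_mul_eq (h : IsDoubleCover x y z) {i j : ℕ} {u v : B}
    (huv : x ^ i * u = y ^ j * v) : ∃ w, u = y ^ j * w ∧ v = x ^ i * w := by
  obtain ⟨w, rfl⟩ := h.pow_dvd i j u v huv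
  exact ⟨w, rfl, h.pow_cancel j (by rw [← huv]; ring)⟩

theorem mem_span_of_pow_mul_mem (h : IsDoubleCover x y z) {M N : ℕ} {c : B}
    (hc : (x * y) ^ M * c ∈ Ideal.span {x ^ (N + M), y ^ (N + M)}) :
    c ∈ Ideal.span {x ^ N, y ^ N} := by
  obtain ⟨α, β, h1⟩ := Ideal.mem_span_pair.1 hc
  obtain ⟨γ, hγ, -⟩ := h.exists_of_pow_mul_eq
    (show x ^ M * (y ^ M * c - α * x ^ N) = y ^ (N + M) * β by linear_combination -h1)
  obtain ⟨δ, hδ, -⟩ := h.exists_of_pow_mul_eq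
    (show x ^ N * α = y ^ M * (c - y ^ N * γ) by linear_combination -hγ)
  refine Ideal.mem_span_pair.2 ⟨δ, γ, h.pow_cancel M ?_⟩
  rw [hδ] at hγ
  linear_combination -hγ

/-- Modulo `(x ^ (N + 1), y ^ (N + 1))`, the elements annihilated by `x` and `y` are the multiples
of `(x y) ^ N`. -/
theorem exists_sub_mem (h : IsDoubleCover x y z) {N : ℕ} {b : B}
    (hx : x * b ∈ Ideal.span {x ^ (N + 1), y ^ (N + 1)})
    (hy : y * b ∈ Ideal.span {x ^ (N + 1), y ^ (N + 1)}) :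
    ∃ d, b - (x * y) ^ N * d ∈ Ideal.span {x ^ (N + 1), y ^ (N + 1)} := by
  obtain ⟨α, β, h1⟩ := Ideal.mem_span_pair.1 hx
  obtain ⟨γ, δ, h2⟩ := Ideal.mem_span_pair.1 hy
  obtain ⟨w, hw, -⟩ := h.exists_of_pow_mul_eq
    (show x ^ 1 * (b - α * x ^ N) = y ^ (N + 1) * β by linear_combination -h1)
  obtain ⟨t, -, ht⟩ := h.exists_of_pow_mul_eq
    (show x ^ (N + 1) * γ = y ^ 1 * (b - δ * y ^ N) by linear_combination h2)
  obtain ⟨d, hd, -⟩ := h.exists_of_pow_mul_eq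
    (show x ^ N * (α - x * t) = y ^ N * (δ - y * w) by linear_combination ht - hw)
  exact ⟨d, Ideal.mem_span_pair.2 ⟨t, w, by linear_combination -hw + x ^ N * (- hd)⟩⟩

theorem mem_maximalIdeal_of_mul_mem (h : IsDoubleCover x y z) {d : B}
    (hd : z * d ∈ Ideal.span {x, y}) : d ∈ maximalIdeal B := by
  rw [mem_maximalIdeal, mem_nonunits_iff]
  intro hu
  exact h.notMem ((Ideal.mul_unit_mem_iff_mem _ hu).1 hd)

end IsDoubleCover

section

variable {p : ℕ} [Fact p.Prime] {B : Type*} [CommRing B] {x y z : B}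

theorem teich_coeff_zero (c : TruncatedWittVector p 1 B) : teich p 1 (c.coeff 0) = c := by
  ext i
  rw [Subsingleton.elim i 0, coeff_teich, if_pos (by simp)]

theorem teich_one_add (a b : B) : teich p 1 (a + b) = teich p 1 a + teich p 1 b := by
  ext i
  rw [Subsingleton.elim i 0, coeff_zero_add, coeff_teich, coeff_teich, coeff_teich]
  simp

theorem mem_teichIdeal_one_iff {c : TruncatedWittVector p 1 B} {N : ℕ} :
    c ∈ teichIdeal p 1 x y N ↔ c.coeff 0 ∈ Ideal.span {x ^ N, y ^ N} := by
  constructor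
  · exact fun h => mem_wittIdeal.1 (teichIdeal_le_wittIdeal x y N h) 0
  · intro h
    obtain ⟨α, β, h⟩ := Ideal.mem_span_pair.1 h
    refine Ideal.mem_span_pair.2 ⟨teich p 1 α, teich p 1 β, ?_⟩
    rw [← map_pow, ← map_pow, ← map_mul, ← map_mul, ← teich_one_add, h, teich_coeff_zero]

variable [IsLocalRing B]

theorem IsDoubleCover.frac_mem_cechBoundary_iff (h : IsDoubleCover x y z)
    (c : TruncatedWittVector p 1 B) (N : ℕ) :
    frac x y c N ∈ cechBoundary p 1 x y ↔ c.coeff 0 ∈ Ideal.span {x ^ N, y ^ N} := by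
  rw [WittLC.frac_mem_cechBoundary_iff]
  constructor
  · rintro ⟨M, hM⟩
    rw [mem_teichIdeal_one_iff, coeff_zero_mul, ← map_pow, coeff_teich, if_pos (by simp)] at hM
    exact h.mem_span_of_pow_mul_mem hM
  · intro hc
    exact ⟨0, by rwa [pow_zero, one_mul, add_zero, mem_teichIdeal_one_iff]⟩

/-- The class of `z / (xy)` generates the socle of `H²_𝔪(B)`. -/
theorem IsDoubleCover.isGenerator (h : IsDoubleCover x y z) :
    LocCoh.IsGenerator (p := p) (maximalIdeal B)
      (Submodule.Quotient.mk (frac x y (teich p 1 z) 1) : LocCoh p 1 x y) := by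
  have hpow : ∀ (c : TruncatedWittVector p 1 B), c • (Submodule.Quotient.mk
      (frac x y (teich p 1 z) 1) : LocCoh p 1 x y) = 0 ↔ c.coeff 0 * z ∈ Ideal.span {x, y} := by
    intro c
    rw [← Submodule.Quotient.mk_smul, Submodule.Quotient.mk_eq_zero, smul_frac,
      h.frac_mem_cechBoundary_iff, coeff_zero_mul, coeff_teich, if_pos (by simp), pow_one, pow_one]
  apply le_antisymm
  · rw [Submodule.span_singleton_le_iff_mem, LocCoh.mem_torsion_iff]
    intro c hc
    rw [hpow]
    obtain ⟨α, β, γ, hc'⟩ := h.exists_eq hc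
    change TruncatedWittVector.coeff 0 c = _ at hc'
    obtain ⟨s, t, hst⟩ := Ideal.mem_span_pair.1 h.sq_mem
    exact Ideal.mem_span_pair.2 ⟨α * z + γ * s, β * z + γ * t, by
      linear_combination γ * hst - z * hc'⟩
  · intro g hg
    rw [LocCoh.mem_torsion_iff] at hg
    obtain ⟨u, rfl⟩ := Submodule.Quotient.mk_surjective _ g
    obtain ⟨b, N, rfl⟩ := exists_eq_frac x y u
    -- pass to a positive exponent
    rw [← frac_teich_pow_mul x y b N 1] at hg ⊢
    generalize teich p 1 (x * y) ^ 1 * b = b at hg ⊢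
    have hkill : ∀ a ∈ maximalIdeal B,
        a * b.coeff 0 ∈ Ideal.span {x ^ (N + 1), y ^ (N + 1)} := by
      intro a ha
      have h1 := hg (teich p 1 a) (by rw [coeff_teich, if_pos rfl]; exact ha)
      rwa [← Submodule.Quotient.mk_smul, Submodule.Quotient.mk_eq_zero, smul_frac,
        h.frac_mem_cechBoundary_iff, coeff_zero_mul, coeff_teich, if_pos (by simp)] at h1
    obtain ⟨d, hd⟩ := h.exists_sub_mem (hkill x h.mem_left) (hkill y h.mem_middle)
    have hzd : z * d ∈ Ideal.span {x, y} := by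
      have h1 : (x * y) ^ N * (z * d) ∈ Ideal.span {x ^ (1 + N), y ^ (1 + N)} := by
        have h2 := Ideal.sub_mem _ (hkill z h.mem_right) (Ideal.mul_mem_left _ z hd)
        rw [add_comm 1 N]
        convert h2 using 1
        ring
      simpa using h.mem_span_of_pow_mul_mem h1
    obtain ⟨α, β, γ, hαβγ⟩ := h.exists_eq (h.mem_maximalIdeal_of_mul_mem hzd)
    refine Submodule.mem_span_singleton.2 ⟨teich p 1 γ, ?_⟩
    rw [← Submodule.Quotient.mk_smul, Submodule.Quotient.eq, smul_frac,
      ← frac_teich_pow_mul x y _ 1 N, add_comm 1 N, ← frac_sub, h.frac_mem_cechBoundary_iff,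
      coeff_zero_sub, ← map_pow, ← map_mul, ← map_mul, coeff_teich, if_pos (by simp)]
    obtain ⟨s, t, hst⟩ := Ideal.mem_span_pair.1 hd
    refine Ideal.mem_span_pair.2 ⟨-s - α * y ^ N, -t - β * x ^ N, ?_⟩
    linear_combination -hst + (x * y) ^ N * hαβγ

end

end WittLC

/-! ### Double covers defined by power series -/

namespace WittLC

open IsLocalRing MvPowerSeries

section

variable {k : Type*} [Field k]

/-- Discarding the terms divisible by `X s`. -/
theorem exists_X_dvd_sub {σ : Type*} (s : σ) (φ : MvPowerSeries σ k) :
    ∃ ψ : MvPowerSeries σ k, X s ∣ φ - ψ ∧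
      (∀ m, m s = 0 → coeff m ψ = coeff m φ) ∧ ∀ m, m s ≠ 0 → coeff m ψ = 0 := by
  classical
  let ψ : MvPowerSeries σ k := fun m => if m s = 0 then coeff m φ else 0
  have hψ : ∀ m, coeff m ψ = if m s = 0 then coeff m φ else 0 := fun m => rfl
  refine ⟨ψ, X_dvd_iff.2 fun m hm => ?_, fun m hm => ?_, fun m hm => ?_⟩
  · rw [map_sub, hψ, if_pos hm, sub_self]
  · rw [hψ, if_pos hm]
  · rw [hψ, if_neg hm]

theorem finsupp_eq_single (m : Fin 3 →₀ ℕ) (h0 : m 0 = 0) (h1 : m 1 = 0) :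
    m = Finsupp.single 2 (m 2) := by
  ext i
  fin_cases i <;> simp [h0, h1]

theorem mem_span_X_iff {φ : MvPowerSeries (Fin 3) k} :
    φ ∈ Ideal.span {X 0, X 1} ↔ ∀ i, coeff (Finsupp.single 2 i) φ = 0 := by
  constructor
  · intro h i
    obtain ⟨a, b, rfl⟩ := Ideal.mem_span_pair.1 h
    rw [map_add, X_dvd_iff.1 (Dvd.intro_left a rfl : X 0 ∣ a * X 0) _ (by simp),
      X_dvd_iff.1 (Dvd.intro_left b rfl : X 1 ∣ b * X 1) _ (by simp), add_zero]
  · intro h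
    obtain ⟨ψ, ⟨a, ha⟩, h1, h2⟩ := exists_X_dvd_sub 0 φ
    obtain ⟨b, hb⟩ : X 1 ∣ ψ := by
      rw [X_dvd_iff]
      intro m hm
      by_cases h0 : m 0 = 0
      · rw [h1 m h0, finsupp_eq_single m h0 hm, h]
      · exact h2 m h0
    exact Ideal.mem_span_pair.2 ⟨a, b, by linear_combination -ha - hb⟩

theorem mem_span_X_of_constantCoeff {φ : MvPowerSeries (Fin 3) k} (h : constantCoeff φ = 0) :
    φ ∈ Ideal.span {X 0, X 1, X 2} := by
  obtain ⟨ψ, ⟨a, ha⟩, h1, h2⟩ := exists_X_dvd_sub 2 φ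
  have hψ : ψ ∈ Ideal.span {X 0, X 1} := by
    rw [mem_span_X_iff]
    intro i
    rcases Nat.eq_zero_or_pos i with rfl | hi
    · rw [h1 _ (by simp)]
      simpa using h
    · exact h2 _ (by simpa using hi.ne')
  obtain ⟨b, c, hbc⟩ := Ideal.mem_span_pair.1 hψ
  refine Ideal.mem_span_insert.2 ⟨b, c * X 1 + a * X 2, Ideal.mem_span_pair.2 ⟨c, a, rfl⟩, ?_⟩
  linear_combination ha - hbc

theorem X_dvd_of_X_dvd_X_mul {φ : MvPowerSeries (Fin 3) k} (h : X 1 ∣ X 0 * φ) : X 1 ∣ φ := by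
  rw [X_dvd_iff] at h ⊢
  intro m hm
  have h1 := h (Finsupp.single 0 1 + m) (by simp [hm])
  rwa [X, coeff_add_monomial_mul, one_mul] at h1

theorem X_one_ne_zero : (X 1 : MvPowerSeries (Fin 3) k) ≠ 0 := by
  classical
  intro h
  have := congrArg (coeff (Finsupp.single 1 1)) h
  rw [coeff_X, if_pos rfl, map_zero] at this
  exact one_ne_zero this

variable {f U V : MvPowerSeries (Fin 3) k} (hf : f = X 2 ^ 2 + X 0 * U + X 1 * V)

include hf

theorem mem_span_X_of_mul_mem {h : MvPowerSeries (Fin 3) k} (hh : f * h ∈ Ideal.span {X 0, X 1}) :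
    h ∈ Ideal.span {X 0, X 1} := by
  have h1 : X 2 ^ 2 * h ∈ Ideal.span {X 0, X 1} := by
    obtain ⟨a, b, hab⟩ := Ideal.mem_span_pair.1 hh
    exact Ideal.mem_span_pair.2 ⟨a - U * h, b - V * h, by linear_combination hab + h * hf⟩
  rw [mem_span_X_iff] at h1 ⊢
  intro i
  have h2 := h1 (2 + i)
  rwa [X_pow_eq, Finsupp.single_add, coeff_add_monomial_mul, one_mul] at h2

theorem X_dvd_of_X_dvd_mul {h : MvPowerSeries (Fin 3) k} (hh : X 1 ∣ f * h) : X 1 ∣ h := by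
  have key : ∀ (a : ℕ) (h : MvPowerSeries (Fin 3) k), X 1 ∣ f * h →
      ∀ m : Fin 3 →₀ ℕ, m 1 = 0 → m 0 = a → coeff m h = 0 := by
    intro a
    induction a with
    | zero =>
      intro h hh m h1 h0
      have h2 := mem_span_X_of_mul_mem hf (Ideal.mem_span_pair.2 ⟨0, hh.choose, by
        rw [zero_mul, zero_add, mul_comm, ← hh.choose_spec]⟩)
      rw [finsupp_eq_single m h0 h1]
      exact mem_span_X_iff.1 h2 _
    | succ a ih =>
      intro h hh m h1 h0
      have h2 := mem_span_X_of_mul_mem hf (Ideal.mem_span_pair.2 ⟨0, hh.choose, by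
        rw [zero_mul, zero_add, mul_comm, ← hh.choose_spec]⟩)
      obtain ⟨b, c, rfl⟩ := Ideal.mem_span_pair.1 h2
      have h3 : X 1 ∣ f * b := by
        apply X_dvd_of_X_dvd_X_mul
        have h4 : X 0 * (f * b) = f * (b * X 0 + c * X 1) - X 1 * (f * c) := by ring
        rw [h4]
        exact dvd_sub hh (Dvd.intro _ rfl)
      have hm : m = Finsupp.single 0 1 + (m - Finsupp.single 0 1) := by
        rw [add_tsub_cancel_of_le]
        rw [Finsupp.single_le_iff]
        omega
      rw [map_add, X_dvd_iff.1 (Dvd.intro_left c rfl : X 1 ∣ c * X 1) m h1, add_zero, hm,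
        mul_comm, X, coeff_add_monomial_mul, one_mul]
      exact ih b h3 _ (by simp [h1]) (by simp [h0])
  exact X_dvd_iff.2 fun m hm => key _ h hh m hm rfl

/-- A power series `z ^ 2 + x u + y v` defines a double cover of the plane. -/
theorem isDoubleCover_of_eq [IsLocalRing (MvPowerSeries (Fin 3) k ⧸ Ideal.span {f})] :
    IsDoubleCover (Ideal.Quotient.mk (Ideal.span {f}) (X 0))
      (Ideal.Quotient.mk (Ideal.span {f}) (X 1)) (Ideal.Quotient.mk (Ideal.span {f}) (X 2)) := by
  set π := Ideal.Quotient.mk (Ideal.span {f})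
  have hπf : π f = 0 := Ideal.Quotient.eq_zero_iff_mem.2 (Ideal.mem_span_singleton_self f)
  have hker : ∀ φ, π φ = 0 → ∃ h, φ = f * h := fun φ hφ =>
    Ideal.mem_span_singleton.1 (Ideal.Quotient.eq_zero_iff_mem.1 hφ)
  have hcf : constantCoeff f = 0 := by
    rw [hf]
    simp
  have hzero : ∀ u, π (X 1) * u = 0 → u = 0 := by
    intro u hu
    obtain ⟨u, rfl⟩ := Ideal.Quotient.mk_surjective u
    obtain ⟨h, hh⟩ := hker (X 1 * u) (by rw [map_mul]; exact hu)
    obtain ⟨h', rfl⟩ := X_dvd_of_X_dvd_mul hf (Dvd.intro _ hh)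
    have h1 : u = f * h' := mul_left_cancel₀ (X_one_ne_zero (k := k)) (by rw [hh]; ring)
    change π u = 0
    rw [h1, map_mul, hπf, zero_mul]
  have hone : ∀ u v, π (X 0) * u = π (X 1) * v → π (X 1) ∣ u := by
    intro u v huv
    obtain ⟨u, rfl⟩ := Ideal.Quotient.mk_surjective u
    obtain ⟨v, rfl⟩ := Ideal.Quotient.mk_surjective v
    obtain ⟨h, hh⟩ := hker (X 0 * u - X 1 * v) (by
      rw [map_sub, map_mul, map_mul]; exact sub_eq_zero.2 huv)
    obtain ⟨a, b, hab⟩ := Ideal.mem_span_pair.1 (mem_span_X_of_mul_mem hf (h := h)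
      (Ideal.mem_span_pair.2 ⟨u, -v, by linear_combination hh⟩))
    obtain ⟨w, hw⟩ := X_dvd_of_X_dvd_X_mul (φ := u - f * a)
      ⟨v + f * b, by linear_combination hh - f * hab⟩
    refine ⟨π w, ?_⟩
    change π u = _
    rw [← map_mul, ← hw, map_sub, map_mul, hπf, zero_mul, sub_zero]
  have hpow : ∀ (j : ℕ) (u v), π (X 0) * u = π (X 1) ^ j * v → π (X 1) ^ j ∣ u := by
    intro j
    induction j with
    | zero => intro u v _; simp
    | succ j ih =>
      intro u v huv
      obtain ⟨u', rfl⟩ := hone u (π (X 1) ^ j * v) (by rw [huv]; ring)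
      obtain ⟨w, rfl⟩ := ih u' v (sub_eq_zero.1 (hzero _ (by linear_combination huv)))
      exact ⟨w, by ring⟩
  refine ⟨?_, ?_, ?_, hzero, ?_⟩
  · apply le_antisymm
    · have hX : ∀ s, π (X s) ∈ maximalIdeal (MvPowerSeries (Fin 3) k ⧸ Ideal.span {f}) := by
        intro s
        rw [mem_maximalIdeal, mem_nonunits_iff]
        intro hu
        obtain ⟨g, hg⟩ := hu.exists_right_inv
        obtain ⟨g, rfl⟩ := Ideal.Quotient.mk_surjective g
        obtain ⟨h, hh⟩ := hker (X s * g - 1) (by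
          rw [map_sub, map_mul, map_one]; exact sub_eq_zero.2 hg)
        have := congrArg constantCoeff hh
        simp [hcf] at this
      rw [Ideal.span_le]
      rintro _ (rfl | rfl | rfl) <;> exact hX _
    · intro u hu
      obtain ⟨φ, rfl⟩ := Ideal.Quotient.mk_surjective u
      have h1 : constantCoeff φ = 0 := by
        by_contra hne
        exact (mem_nonunits_iff.1 hu) ((isUnit_iff_constantCoeff.2 (IsUnit.mk0 _ hne)).map π)
      have h2 := Ideal.mem_map_of_mem π (mem_span_X_of_constantCoeff h1)
      rwa [Ideal.map_span, Set.image_insert_eq, Set.image_pair] at h2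
  · refine Ideal.mem_span_pair.2 ⟨-π U, -π V, ?_⟩
    have := congrArg π hf
    rw [hπf] at this
    simp only [map_add, map_mul, map_pow] at this
    linear_combination this
  · intro hz
    obtain ⟨a, b, hab⟩ := Ideal.mem_span_pair.1 hz
    obtain ⟨a, rfl⟩ := Ideal.Quotient.mk_surjective a
    obtain ⟨b, rfl⟩ := Ideal.Quotient.mk_surjective b
    obtain ⟨h, hh⟩ := hker (a * X 0 + b * X 1 - X 2) (by
      rw [map_sub, map_add, map_mul, map_mul]; exact sub_eq_zero.2 hab)
    have h1 : X 2 + X 2 ^ 2 * h ∈ Ideal.span {X 0, X 1} :=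
      Ideal.mem_span_pair.2 ⟨a - U * h, b - V * h, by linear_combination hh + h * hf⟩
    have h2 := mem_span_X_iff.1 h1 1
    rw [map_add, X_pow_dvd_iff.1 (Dvd.intro h rfl : X 2 ^ 2 ∣ X 2 ^ 2 * h) _ (by simp),
      add_zero] at h2
    classical
    rw [coeff_X, if_pos rfl] at h2
    exact one_ne_zero h2
  · intro i j
    induction i with
    | zero => intro u v huv; exact ⟨v, by simpa using huv⟩
    | succ i ih =>
      intro u v huv
      obtain ⟨w, hw⟩ := hpow j (π (X 0) ^ i * u) v (by rw [← huv]; ring)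
      exact ih u w hw

end

end WittLC

/-! ### Sums of Teichmüller representatives -/

namespace WittLC

section

open WittVector

theorem teichmuller_add_coeff_zero (p : ℕ) [Fact p.Prime] {R : Type*} [CommRing R] (s t : R) :
    (teichmuller p s + teichmuller p t).coeff 0 = s + t := by
  rw [add_coeff_zero, teichmuller_coeff_zero, teichmuller_coeff_zero]

theorem teichmuller_add_ghost_one {p : ℕ} [Fact p.Prime] {R : Type*} [CommRing R] (s t : R) :
    (s + t) ^ p + p * (teichmuller p s + teichmuller p t).coeff 1 = s ^ p + t ^ p := by
  have h := ghostComponent_apply 1 (teichmuller p s + teichmuller p t)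
  rw [map_add, ghostComponent_teichmuller, ghostComponent_teichmuller, aeval_wittPolynomial] at h
  rw [← teichmuller_add_coeff_zero p s t]
  simpa [Finset.sum_range_succ] using h.symm

theorem teichmuller_add_ghost_two {p : ℕ} [Fact p.Prime] {R : Type*} [CommRing R] (s t : R) :
    (s + t) ^ p ^ 2 + p * (teichmuller p s + teichmuller p t).coeff 1 ^ p +
      p ^ 2 * (teichmuller p s + teichmuller p t).coeff 2 = s ^ p ^ 2 + t ^ p ^ 2 := by
  have h := ghostComponent_apply 2 (teichmuller p s + teichmuller p t)
  rw [map_add, ghostComponent_teichmuller, ghostComponent_teichmuller, aeval_wittPolynomial] at h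
  rw [← teichmuller_add_coeff_zero p s t]
  simpa [Finset.sum_range_succ] using h.symm

/-- A universal formula for a component of `[s] + [t]` holds over every ring if it holds over
polynomial rings over `ℤ`. -/
theorem teichmuller_add_coeff_of_mvPolynomial {p : ℕ} [Fact p.Prime] {R : Type*} [CommRing R]
    {i : ℕ} (P : ∀ (S : Type _) [CommRing S], S → S → S)
    (hP : ∀ (S T : Type _) [CommRing S] [CommRing T] (f : S →+* T) (a b : S),
      f (P S a b) = P T (f a) (f b))
    (h : ∀ a b : MvPolynomial R ℤ, (teichmuller p a + teichmuller p b).coeff i = P _ a b)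
    (s t : R) : (teichmuller p s + teichmuller p t).coeff i = P R s t := by
  obtain ⟨s, rfl⟩ := MvPolynomial.counit_surjective R s
  obtain ⟨t, rfl⟩ := MvPolynomial.counit_surjective R t
  rw [← map_teichmuller, ← map_teichmuller, ← map_add, map_coeff, h, hP]

theorem teichmuller_two_add_coeff_one {R : Type*} [CommRing R] (s t : R) :
    (teichmuller 2 s + teichmuller 2 t).coeff 1 = -(s * t) := by
  refine teichmuller_add_coeff_of_mvPolynomial (p := 2) (fun S _ a b => -(a * b))
    (fun S T _ _ f a b => ?_) (fun a b => ?_) s t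
  · rw [map_neg, map_mul]
  · apply mul_left_cancel₀ (by norm_num : (2 : MvPolynomial R ℤ) ≠ 0)
    have := teichmuller_add_ghost_one (p := 2) a b
    push_cast at this
    linear_combination this

theorem teichmuller_two_add_coeff_two {R : Type*} [CommRing R] (s t : R) :
    (teichmuller 2 s + teichmuller 2 t).coeff 2 =
      -(s ^ 3 * t + 2 * s ^ 2 * t ^ 2 + s * t ^ 3) := by
  refine teichmuller_add_coeff_of_mvPolynomial (p := 2)
    (fun S _ a b => -(a ^ 3 * b + 2 * a ^ 2 * b ^ 2 + a * b ^ 3)) (fun S T _ _ f a b => ?_)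
    (fun a b => ?_) s t
  · simp only [map_neg, map_mul, map_add, map_pow, map_ofNat]
  · apply mul_left_cancel₀ (by norm_num : (4 : MvPolynomial R ℤ) ≠ 0)
    have := teichmuller_add_ghost_two (p := 2) a b
    rw [teichmuller_two_add_coeff_one] at this
    push_cast at this
    linear_combination this

theorem teichmuller_three_add_coeff_one {R : Type*} [CommRing R] (s t : R) :
    (teichmuller 3 s + teichmuller 3 t).coeff 1 = -(s ^ 2 * t + s * t ^ 2) := by
  refine teichmuller_add_coeff_of_mvPolynomial (p := 3) (fun S _ a b => -(a ^ 2 * b + a * b ^ 2))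
    (fun S T _ _ f a b => ?_) (fun a b => ?_) s t
  · simp only [map_neg, map_mul, map_add, map_pow]
  · apply mul_left_cancel₀ (by norm_num : (3 : MvPolynomial R ℤ) ≠ 0)
    have := teichmuller_add_ghost_one (p := 3) a b
    push_cast at this
    linear_combination this

end

section

variable {p : ℕ} [Fact p.Prime] {n : ℕ} {R : Type*} [CommRing R]

theorem coeff_teich_add (s t : R) (i : Fin n) : (teich p n s + teich p n t).coeff i =
    (WittVector.teichmuller p s + WittVector.teichmuller p t).coeff i := by
  rw [teich_eq, teich_eq, ← map_add, WittVector.coeff_truncate]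

theorem eq_teich_add_verschiebung_teich (c : TruncatedWittVector p 2 R) :
    c = teich p 2 (c.coeff 0) + verschiebungPow p (Nat.le_succ 1) R (teich p 1 (c.coeff 1)) := by
  conv_lhs => rw [← teich_add_verschiebung_wittTail c]
  congr 2
  rw [← teich_coeff_zero (wittTail c)]
  rfl

theorem teich_two_add_teich (s t : R) : teich 2 2 s + teich 2 2 t = teich 2 2 (s + t) +
    verschiebungPow 2 (Nat.le_succ 1) R (teich 2 1 (-(s * t))) := by
  rw [eq_teich_add_verschiebung_teich (teich 2 2 s + teich 2 2 t), coeff_teich_add, coeff_teich_add]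
  congr 3
  · exact teichmuller_add_coeff_zero 2 s t
  · exact teichmuller_two_add_coeff_one s t

theorem teich_three_add_teich (s t : R) : teich 3 2 s + teich 3 2 t = teich 3 2 (s + t) +
    verschiebungPow 3 (Nat.le_succ 1) R (teich 3 1 (-(s ^ 2 * t + s * t ^ 2))) := by
  rw [eq_teich_add_verschiebung_teich (teich 3 2 s + teich 3 2 t), coeff_teich_add, coeff_teich_add]
  congr 3
  · exact teichmuller_add_coeff_zero 3 s t
  · exact teichmuller_three_add_coeff_one s t

theorem teich_two_add_teich_length_three (s t : R) : teich 2 3 s + teich 2 3 t =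
    teich 2 3 (s + t) + verschiebungPow 2 (Nat.le_succ 2) R (teich 2 2 (-(s * t)) +
      verschiebungPow 2 (Nat.le_succ 1) R
        (teich 2 1 (-(s ^ 3 * t + 2 * s ^ 2 * t ^ 2 + s * t ^ 3)))) := by
  conv_lhs => rw [← teich_add_verschiebung_wittTail (teich 2 3 s + teich 2 3 t),
    eq_teich_add_verschiebung_teich (wittTail _), coeff_wittTail, coeff_wittTail, coeff_teich_add,
    coeff_teich_add, coeff_teich_add]
  congr 3
  · exact teichmuller_add_coeff_zero 2 s t
  · exact congrArg _ (teichmuller_two_add_coeff_one s t)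
  · exact congrArg _ (congrArg _ (teichmuller_two_add_coeff_two s t))

theorem verschiebungPow_verschiebungPow {l m n : ℕ} (h : l ≤ m) (h' : m ≤ n)
    (c : TruncatedWittVector p l R) :
    verschiebungPow p h' R (verschiebungPow p h R c) = verschiebungPow p (h.trans h') R c := by
  ext i
  rw [coeff_verschiebungPow, coeff_verschiebungPow]
  split_ifs with h1 h2 h2
  · rfl
  · omega
  · rw [coeff_verschiebungPow, dif_pos (by simp only; omega)]
  · rw [coeff_verschiebungPow, dif_neg (by simp only; omega)]
    congr 1
    ext
    simp only
    omega

end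

end WittLC

/-! ### Coboundaries from Teichmüller representatives -/

namespace WittLC

open IsLocalRing

/-- The elements of `R + L`, for two subrings `L` and `R`. -/
def IsSplit {C : Type*} [CommRing C] (L R : Subring C) (c : C) : Prop :=
  ∃ a ∈ R, ∃ b ∈ L, c = a + b

section

variable {p : ℕ} [Fact p.Prime] {n : ℕ} {B : Type*} [CommRing B] {x y : B}

theorem teich_mem_of_left {c : Localization.Away (x * y)} (hc : c ∈ (locLeft x y).range) :
    teich p n c ∈ cechBoundary p n x y := by
  obtain ⟨a, rfl⟩ := hc
  exact ⟨teich p n a, 0, by rw [wittMap_teich, map_zero, add_zero]⟩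

theorem teich_mem_of_right {c : Localization.Away (x * y)} (hc : c ∈ (locRight x y).range) :
    teich p n c ∈ cechBoundary p n x y := by
  obtain ⟨a, rfl⟩ := hc
  exact ⟨0, teich p n a, by rw [wittMap_teich, map_zero, zero_add]⟩

theorem verschiebungPow_mem {m : ℕ} (h : m ≤ n)
    {u : TruncatedWittVector p m (Localization.Away (x * y))} (hu : u ∈ cechBoundary p m x y) :
    verschiebungPow p h _ u ∈ cechBoundary p n x y := by
  obtain ⟨a, b, rfl⟩ := hu
  exact ⟨verschiebungPow p h _ a, verschiebungPow p h _ b, by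
    rw [map_add, wittMap_verschiebungPow, wittMap_verschiebungPow]⟩

theorem truncate_mem {m : ℕ} (h : m ≤ n)
    {u : TruncatedWittVector p n (Localization.Away (x * y))} (hu : u ∈ cechBoundary p n x y) :
    TruncatedWittVector.truncate h u ∈ cechBoundary p m x y := by
  obtain ⟨a, b, rfl⟩ := hu
  exact ⟨TruncatedWittVector.truncate h a, TruncatedWittVector.truncate h b, by
    rw [map_add, wittMap_truncate, wittMap_truncate]⟩

theorem truncate_teich {R : Type*} [CommRing R] {m : ℕ} (h : m ≤ n) (a : R) :
    TruncatedWittVector.truncate h (teich p n a) = teich p m a := by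
  ext i
  rw [TruncatedWittVector.coeff_truncate, coeff_teich, coeff_teich]
  simp

theorem truncate_verschiebungPow {R : Type*} [CommRing R] {l m : ℕ} (h : m ≤ n) (h' : l ≤ n)
    (hlm : l + m ≤ n) (a : TruncatedWittVector p l R) :
    TruncatedWittVector.truncate h (verschiebungPow p h' R a) = 0 := by
  ext i
  rw [TruncatedWittVector.coeff_truncate, coeff_verschiebungPow, dif_pos (by simp; omega),
    TruncatedWittVector.coeff_zero]

theorem teich_one_sub {R : Type*} [CommRing R] (a b : R) :
    teich p 1 (a - b) = teich p 1 a - teich p 1 b := by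
  rw [eq_sub_iff_add_eq, ← teich_one_add, sub_add_cancel]

theorem teich_one_mem {c : Localization.Away (x * y)}
    (hc : IsSplit (locLeft x y).range (locRight x y).range c) :
    teich p 1 c ∈ cechBoundary p 1 x y := by
  obtain ⟨a, ha, b, hb, rfl⟩ := hc
  rw [teich_one_add]
  exact Submodule.add_mem _ (teich_mem_of_right ha) (teich_mem_of_left hb)

theorem verschiebungPow_self {R : Type*} [CommRing R] (c : TruncatedWittVector p n R) :
    verschiebungPow p le_rfl R c = c := by
  ext i
  rw [coeff_verschiebungPow, dif_neg (by simp)]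
  simp

theorem teich_one_sub_mem {c d : Localization.Away (x * y)}
    (h : IsSplit (locLeft x y).range (locRight x y).range (c - d)) :
    teich p 1 c - verschiebungPow p le_rfl _ (teich p 1 d) ∈ cechBoundary p 1 x y := by
  rw [verschiebungPow_self, ← teich_one_sub]
  exact teich_one_mem h

/-- In characteristic two, `[t + v] = [t] + [v] + V [tv]` in length two. The element `d` marks the
part of `tv` that will be kept. -/
theorem teich_two_add_eq {R : Type*} [CommRing R] (h2 : (2 : R) = 0) (t v d : R) :
    teich 2 2 (t + v) - verschiebungPow 2 (Nat.le_succ 1) _ (teich 2 1 d) =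
      teich 2 2 t + teich 2 2 v - verschiebungPow 2 (Nat.le_succ 1) _ (teich 2 1 (t * v - d)) := by
  have h1 : -(t * v) = t * v := by linear_combination -(t * v) * h2
  have hd : teich 2 1 d = -teich 2 1 d := by
    rw [eq_neg_iff_add_eq_zero, ← teich_one_add, ← two_mul, h2, zero_mul, teich_zero]
  set V := verschiebungPow 2 (Nat.le_succ 1) R
  have hV : V (teich 2 1 d) = -V (teich 2 1 d) := by
    rw [← V.map_neg, ← hd]
  have hadd : teich 2 2 t + teich 2 2 v = teich 2 2 (t + v) + V (teich 2 1 (t * v)) := by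
    rw [teich_two_add_teich, h1]
  have hsub : V (teich 2 1 (t * v - d)) = V (teich 2 1 (t * v)) - V (teich 2 1 d) := by
    rw [teich_one_sub (p := 2) (t * v) d, V.map_sub]
  rw [hadd, hsub]
  linear_combination -hV

theorem teich_three_add_eq {R : Type*} [CommRing R] (t v d : R) :
    teich 3 2 (t + v) - verschiebungPow 3 (Nat.le_succ 1) _ (teich 3 1 d) =
      teich 3 2 t + teich 3 2 v + verschiebungPow 3 (Nat.le_succ 1) _
        (teich 3 1 (t ^ 2 * v + t * v ^ 2 - d)) := by
  rw [teich_three_add_teich, ← zero_sub (t ^ 2 * v + t * v ^ 2), teich_one_sub, teich_one_sub,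
    teich_zero, (verschiebungPow 3 (Nat.le_succ 1) R).map_sub,
    (verschiebungPow 3 (Nat.le_succ 1) R).map_sub, map_zero]
  abel

theorem teich_two_add_eq_length_three {R : Type*} [CommRing R] (h2 : (2 : R) = 0)
    {t v t' v' : R} (d : R) (htv : t * v = t' + v') :
    teich 2 3 (t + v) - verschiebungPow 2 (by omega) _ (teich 2 1 d) =
      teich 2 3 t + teich 2 3 v - verschiebungPow 2 (Nat.le_succ 2) _
        (teich 2 2 (t' + v') - verschiebungPow 2 (Nat.le_succ 1) _ (teich 2 1 d) +
          verschiebungPow 2 (Nat.le_succ 1) _ (teich 2 1 (t ^ 3 * v + t * v ^ 3))) := by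
  have h1 : -(t * v) = t' + v' := by linear_combination -(t * v) * h2 + htv
  have h3 : -(t ^ 3 * v + 2 * t ^ 2 * v ^ 2 + t * v ^ 3) = t ^ 3 * v + t * v ^ 3 := by
    linear_combination -(t ^ 3 * v + t * v ^ 3 + t ^ 2 * v ^ 2) * h2
  have hd : teich 2 1 d = -teich 2 1 d := by
    rw [eq_neg_iff_add_eq_zero, ← teich_one_add, ← two_mul, h2, zero_mul, teich_zero]
  set V := verschiebungPow 2 (Nat.le_succ 2) R
  set V' := verschiebungPow 2 (Nat.le_succ 1) R
  have hV : verschiebungPow 2 (by omega) R (teich 2 1 d) = V (V' (-teich 2 1 d)) := by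
    rw [← hd]
    exact (verschiebungPow_verschiebungPow (Nat.le_succ 1) (Nat.le_succ 2) _).symm
  rw [teich_two_add_teich_length_three, h1, h3, hV, V.map_add, V.map_add, V.map_sub, V'.map_neg,
    V.map_neg]
  abel

variable {t v t' v' d : Localization.Away (x * y)}

theorem teich_two_length_two_mem (h2 : (2 : Localization.Away (x * y)) = 0)
    (ht : t ∈ (locRight x y).range) (hv : v ∈ (locLeft x y).range)
    (h : IsSplit (locLeft x y).range (locRight x y).range (t * v - d)) :
    teich 2 2 (t + v) - verschiebungPow 2 (Nat.le_succ 1) _ (teich 2 1 d) ∈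
      cechBoundary 2 2 x y := by
  rw [teich_two_add_eq h2]
  exact Submodule.sub_mem _
    (Submodule.add_mem _ (teich_mem_of_right ht) (teich_mem_of_left hv))
    (verschiebungPow_mem _ (teich_one_mem h))

theorem teich_three_length_two_mem (ht : t ∈ (locRight x y).range) (hv : v ∈ (locLeft x y).range)
    (h : IsSplit (locLeft x y).range (locRight x y).range (t ^ 2 * v + t * v ^ 2 - d)) :
    teich 3 2 (t + v) - verschiebungPow 3 (Nat.le_succ 1) _ (teich 3 1 d) ∈
      cechBoundary 3 2 x y := by
  rw [teich_three_add_eq]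
  exact Submodule.add_mem _
    (Submodule.add_mem _ (teich_mem_of_right ht) (teich_mem_of_left hv))
    (verschiebungPow_mem _ (teich_one_mem h))

theorem teich_two_length_three_mem (h2 : (2 : Localization.Away (x * y)) = 0)
    (ht : t ∈ (locRight x y).range) (hv : v ∈ (locLeft x y).range)
    (htv : t * v = t' + v') (ht' : t' ∈ (locRight x y).range) (hv' : v' ∈ (locLeft x y).range)
    (h : IsSplit (locLeft x y).range (locRight x y).range (t' * v' - d))
    (h' : IsSplit (locLeft x y).range (locRight x y).range (t ^ 3 * v + t * v ^ 3)) :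
    teich 2 3 (t + v) - verschiebungPow 2 (by omega) _ (teich 2 1 d) ∈ cechBoundary 2 3 x y := by
  rw [teich_two_add_eq_length_three h2 d htv]
  exact Submodule.sub_mem _
    (Submodule.add_mem _ (teich_mem_of_right ht) (teich_mem_of_left hv))
    (verschiebungPow_mem _ (Submodule.add_mem _ (teich_two_length_two_mem h2 ht' hv' h)
      (verschiebungPow_mem _ (teich_one_mem h'))))

/-- The membership statements that make `[z / (xy)]` a class with the desired Frobenius: it is
annihilated by `[z]`, and its Frobenius is `V^{n-1} (c z / (xy))`. -/
def TeichFrobenius (p : ℕ) [Fact p.Prime] {n : ℕ} (hn : 1 ≤ n) (x y z c : B) : Prop :=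
  teich p n (algebraMap B (Localization.Away (x * y)) z *
    (algebraMap B _ z * IsLocalization.Away.invSelf (x * y))) ∈ cechBoundary p n x y ∧
  teich p n ((algebraMap B _ z * IsLocalization.Away.invSelf (x * y)) ^ p) -
    verschiebungPow p hn _ (teich p 1 (algebraMap B (Localization.Away (x * y)) c *
      (algebraMap B _ z * IsLocalization.Away.invSelf (x * y)))) ∈ cechBoundary p n x y

theorem TeichFrobenius.of_lt {m : ℕ} {hn : 1 ≤ n} {z c : B} (h : TeichFrobenius p hn x y z c)
    (hm : 1 ≤ m) (hmn : m < n) : TeichFrobenius p hm x y z 0 := by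
  refine ⟨?_, ?_⟩
  · have := truncate_mem hmn.le h.1
    rwa [truncate_teich] at this
  · have := truncate_mem hmn.le h.2
    rw [map_sub, truncate_teich, truncate_verschiebungPow _ _ (by omega)] at this
    rwa [map_zero, zero_mul, teich_zero, map_zero]

variable [IsLocalRing B]

/-- If `[z / (xy)]` is annihilated by `[z]`, and its Frobenius is a coboundary in length `n - 1`,
then it is annihilated by all Witt vectors with first component in the maximal ideal, because
`V(c) [w] = V(c F[w])`. -/
theorem TeichFrobenius.mem_torsion {z c : B} (hD : IsDoubleCover x y z) {hn : 1 ≤ n}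
    (h : TeichFrobenius p hn x y z c) :
    (Submodule.Quotient.mk (frac x y (teich p n z) 1) : LocCoh p n x y) ∈
      LocCoh.torsion p hn x y (maximalIdeal B) := by
  obtain ⟨m, rfl⟩ : ∃ m, n = m + 1 := ⟨n - 1, by omega⟩
  rw [LocCoh.mem_torsion_iff]
  intro a ha
  obtain ⟨α, β, γ, hab⟩ := hD.exists_eq ha
  set w := algebraMap B (Localization.Away (x * y)) z * IsLocalization.Away.invSelf (x * y) with hw
  have hfrac : frac x y (teich p (m + 1) z) 1 = teich p (m + 1) w := by
    rw [frac, pow_one, wittMap_teich, ← map_mul]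
  set a' := a - teich p (m + 1) α * teich p (m + 1) x - teich p (m + 1) β * teich p (m + 1) y -
    teich p (m + 1) γ * teich p (m + 1) z with ha'
  have ha'0 : a'.coeff 0 = 0 := by
    rw [ha', coeff_zero_sub, coeff_zero_sub, coeff_zero_sub, ← map_mul, ← map_mul, ← map_mul,
      coeff_teich, coeff_teich, coeff_teich]
    simp only [Fin.val_zero, if_true]
    change TruncatedWittVector.coeff 0 a = _ at hab
    rw [hab]
    ring
  have haeq : a = a' + teich p (m + 1) α * teich p (m + 1) x +
      teich p (m + 1) β * teich p (m + 1) y + teich p (m + 1) γ * teich p (m + 1) z := by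
    rw [ha']
    ring
  rw [← Submodule.Quotient.mk_smul, Submodule.Quotient.mk_eq_zero, haeq, add_smul, add_smul,
    add_smul, mul_smul, mul_smul, mul_smul]
  refine Submodule.add_mem _ (Submodule.add_mem _ (Submodule.add_mem _ ?_
    (Submodule.smul_mem _ _ ?_)) (Submodule.smul_mem _ _ ?_)) (Submodule.smul_mem _ _ ?_)
  · have hpred : teich p m (w ^ p) ∈ cechBoundary p m x y := by
      have := truncate_mem m.le_succ h.2
      rwa [map_sub, truncate_teich, truncate_verschiebungPow _ _ (by omega), sub_zero] at this
    rw [hfrac, ← verschiebung_wittTail a' ha'0]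
    have h1 : verschiebungPow p m.le_succ B (wittTail a') • teich p (m + 1) w =
        verschiebungPow p m.le_succ _ (wittTail a' • teich p m (w ^ p)) := by
      change wittMap p (m + 1) (algebraMap B _) _ * _ =
        verschiebungPow p m.le_succ _ (wittMap p m (algebraMap B _) _ * _)
      rw [wittMap_verschiebungPow, mul_comm _ (teich p (m + 1) w), teich_mul_verschiebung,
        mul_comm (teich p m _)]
    rw [h1]
    exact verschiebungPow_mem _ (Submodule.smul_mem _ _ hpred)
  · rw [smul_frac]
    exact frac_mem_cechBoundary_of_mem_teichIdeal _ _ _ _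
      (Ideal.mem_span_pair.2 ⟨teich p (m + 1) z, 0, by ring⟩)
  · rw [smul_frac]
    exact frac_mem_cechBoundary_of_mem_teichIdeal _ _ _ _
      (Ideal.mem_span_pair.2 ⟨0, teich p (m + 1) z, by ring⟩)
  · rw [hfrac]
    have h1 := h.1
    rw [map_mul] at h1
    change wittMap p (m + 1) (algebraMap B _) _ * _ ∈ _
    rwa [wittMap_teich]

theorem TeichFrobenius.hasFrobeniusClass [CharP B p] {z c : B} (hD : IsDoubleCover x y z)
    {hn : 1 ≤ n} (h : TeichFrobenius p hn x y z c) {P Q : Prop} (hP : P → c = 0) (hQ : Q → IsUnit c) :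
    HasFrobeniusClass p hn x y (maximalIdeal B) P Q := by
  set w := algebraMap B (Localization.Away (x * y)) z * IsLocalization.Away.invSelf (x * y) with hw
  have hfrac : ∀ m, frac x y (teich p m z) 1 = teich p m w := by
    intro m
    rw [frac, pow_one, wittMap_teich, ← map_mul]
  have hF : LocCoh.F p n x y (Submodule.Quotient.mk (frac x y (teich p n z) 1)) =
      LocCoh.V p hn x y (Submodule.Quotient.mk (frac x y (teich p 1 (c * z)) 1)) := by
    rw [LocCoh.F_mk, LocCoh.V_mk, Submodule.Quotient.eq, hfrac, wittMap_teich, frac, pow_one,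
      wittMap_teich, ← map_mul (teich p 1), map_mul (algebraMap B _), mul_assoc]
    exact h.2
  refine ⟨_, h.mem_torsion hD, ?_, fun hp => ?_, fun hq => ?_⟩
  · rw [LocCoh.R_mk, hfrac, truncate_teich, ← hfrac]
    exact hD.isGenerator
  · rw [hF, hP hp, zero_mul, teich_zero, frac, map_zero, zero_mul, Submodule.Quotient.mk_zero,
      map_zero]
  · have hg := (hD.unit_mul (hQ hq)).isGenerator (p := p)
    refine ⟨_, ?_, hg, hF⟩
    rw [← hg]
    exact Submodule.mem_span_singleton_self _

end

end WittLC

/-! ### The Frobenius of `z / (xy)` for Artin's equations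

For each equation, `ξ` and `η` stand for `1 / x` and `1 / y`. The first assertion of each lemma
concerns `z · z / (xy)` and the second one `(z / (xy)) ^ p`; the equation rewrites both as a sum of
an element of `B[1/y]` and an element of `B[1/x]`, up to a multiple `c z / (xy)` if the length is
one. In greater length the multiple comes from the last cross term in the addition of the
Teichmüller representatives of the two summands. In each proof `grind` verifies the ring identities
and the remaining goals are memberships in `L` or `R`. -/

namespace WittLC

/-- Subrings `L` and `R` of a ring in which `X` and `Y` have inverses `ξ` and `η`, where `L`
contains `X, Y, Z, ξ` and `R` contains `X, Y, Z, η`. -/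
structure Chart {C : Type*} [CommRing C] (L R : Subring C) (X Y Z ξ η : C) : Prop where
  mul_xi : X * ξ = 1
  mul_eta : Y * η = 1
  X_mem_left : X ∈ L
  Y_mem_left : Y ∈ L
  Z_mem_left : Z ∈ L
  xi_mem_left : ξ ∈ L
  X_mem_right : X ∈ R
  Y_mem_right : Y ∈ R
  Z_mem_right : Z ∈ R
  eta_mem_right : η ∈ R

/-- A decomposition of `c` whose cross term for Witt vectors of length two in characteristic two
agrees with `d` up to `R + L`. -/
def SplitTwo {C : Type*} [CommRing C] (L R : Subring C) (c d : C) : Prop :=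
  ∃ t ∈ R, ∃ v ∈ L, c = t + v ∧ IsSplit L R (t * v - d)

/-- A decomposition of `c` whose cross term for Witt vectors of length two in characteristic three
agrees with `d` up to `R + L`. -/
def SplitTwoThree {C : Type*} [CommRing C] (L R : Subring C) (c d : C) : Prop :=
  ∃ t ∈ R, ∃ v ∈ L, c = t + v ∧ IsSplit L R (t ^ 2 * v + t * v ^ 2 - d)

/-- A decomposition of `c` whose cross terms for Witt vectors of length three in characteristic two
vanish up to `R + L`, except for the last one, which agrees with `d` up to `R + L`. -/
def SplitThree {C : Type*} [CommRing C] (L R : Subring C) (c d : C) : Prop :=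
  ∃ t ∈ R, ∃ v ∈ L, c = t + v ∧ (∃ t' ∈ R, ∃ v' ∈ L, t * v = t' + v' ∧ IsSplit L R (t' * v' - d)) ∧
    IsSplit L R (t ^ 3 * v + t * v ^ 3)

section

set_option linter.unusedTactic false
set_option linter.unreachableTactic false

variable {C : Type*} [CommRing C] {L R : Subring C} {X Y Z ξ η : C} {c : C}

theorem split_two_E6_zero (h : Chart L R X Y Z ξ η) (hp : (2 : C) = 0)
    (hZ : Z ^ 2 + X ^ 3 + Y ^ 2 * Z = 0) (hc : c = 0) :
    IsSplit L R (Z * (Z * ξ * η)) ∧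
      IsSplit L R ((Z * ξ * η) ^ 2 - c * (Z * ξ * η)) := by
  obtain ⟨hX, hY, _, _, _, _, _, _, _, _⟩ := h
  subst hc
  refine ⟨?_, ?_⟩
  · refine ⟨X ^ 2 * η, ?_, Y * Z * ξ, ?_, ?_⟩ <;>
      first
      | grind
      | repeat' first
          | assumption | apply add_mem | apply mul_mem | apply pow_mem | apply neg_mem
          | apply zero_mem | apply ofNat_mem
  · refine ⟨X * η ^ 2, ?_, Z * ξ ^ 2, ?_, ?_⟩ <;>
      first
      | grind
      | repeat' first
          | assumption | apply add_mem | apply mul_mem | apply pow_mem | apply neg_mem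
          | apply zero_mem | apply ofNat_mem

theorem split_two_E6_one (h : Chart L R X Y Z ξ η) (hp : (2 : C) = 0)
    (hZ : Z ^ 2 + X ^ 3 + Y ^ 2 * Z + X * Y * Z = 0) (hc : c = 1) :
    IsSplit L R (Z * (Z * ξ * η)) ∧
      IsSplit L R ((Z * ξ * η) ^ 2 - c * (Z * ξ * η)) := by
  obtain ⟨hX, hY, _, _, _, _, _, _, _, _⟩ := h
  subst hc
  refine ⟨?_, ?_⟩
  · refine ⟨X ^ 2 * η, ?_, Y * Z * ξ + Z, ?_, ?_⟩ <;>
      first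
      | grind
      | repeat' first
          | assumption | apply add_mem | apply mul_mem | apply pow_mem | apply neg_mem
          | apply zero_mem | apply ofNat_mem
  · refine ⟨X * η ^ 2, ?_, Z * ξ ^ 2, ?_, ?_⟩ <;>
      first
      | grind
      | repeat' first
          | assumption | apply add_mem | apply mul_mem | apply pow_mem | apply neg_mem
          | apply zero_mem | apply ofNat_mem

theorem split_two_E7_three (h : Chart L R X Y Z ξ η) (hp : (2 : C) = 0)
    (hZ : Z ^ 2 + X ^ 3 + X * Y ^ 3 + Z * X * Y = 0) (hc : c = 1) :
    IsSplit L R (Z * (Z * ξ * η)) ∧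
      IsSplit L R ((Z * ξ * η) ^ 2 - c * (Z * ξ * η)) := by
  obtain ⟨hX, hY, _, _, _, _, _, _, _, _⟩ := h
  subst hc
  refine ⟨?_, ?_⟩
  · refine ⟨X ^ 2 * η, ?_, Y ^ 2 + Z, ?_, ?_⟩ <;>
      first
      | grind
      | repeat' first
          | assumption | apply add_mem | apply mul_mem | apply pow_mem | apply neg_mem
          | apply zero_mem | apply ofNat_mem
  · refine ⟨X * η ^ 2, ?_, Y * ξ, ?_, ?_⟩ <;>
      first
      | grind
      | repeat' first
          | assumption | apply add_mem | apply mul_mem | apply pow_mem | apply neg_mem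
          | apply zero_mem | apply ofNat_mem

theorem split_two_E7_two (h : Chart L R X Y Z ξ η) (hp : (2 : C) = 0)
    (hZ : Z ^ 2 + X ^ 3 + X * Y ^ 3 + Z * Y ^ 3 = 0) (hc : c = 1) :
    SplitTwo L R (Z * (Z * ξ * η)) 0 ∧
      SplitTwo L R ((Z * ξ * η) ^ 2) (c * (Z * ξ * η)) := by
  obtain ⟨hX, hY, _, _, _, _, _, _, _, _⟩ := h
  subst hc
  refine ⟨?_, ?_⟩
  · refine ⟨X ^ 2 * η, ?_, Y ^ 2 + Y ^ 2 * Z * ξ, ?_, ?_, 0, ?_, X ^ 2 * Y + X * Y * Z, ?_, ?_⟩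
      <;>
      first
      | grind
      | repeat' first
          | assumption | apply add_mem | apply mul_mem | apply pow_mem | apply neg_mem
          | apply zero_mem | apply ofNat_mem
  · refine ⟨X * η ^ 2, ?_, Y * ξ + Z * Y * ξ ^ 2, ?_, ?_, η, ?_, 0, ?_, ?_⟩ <;>
      first
      | grind
      | repeat' first
          | assumption | apply add_mem | apply mul_mem | apply pow_mem | apply neg_mem
          | apply zero_mem | apply ofNat_mem

theorem split_two_E7_one (h : Chart L R X Y Z ξ η) (hp : (2 : C) = 0)
    (hZ : Z ^ 2 + X ^ 3 + X * Y ^ 3 + Z * X ^ 2 * Y = 0) (hc : c = 1) :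
    SplitThree L R (Z * (Z * ξ * η)) 0 ∧
      SplitThree L R ((Z * ξ * η) ^ 2) (c * (Z * ξ * η)) := by
  obtain ⟨hX, hY, _, _, _, _, _, _, _, _⟩ := h
  subst hc
  refine ⟨?_, ?_⟩
  · refine ⟨X ^ 2 * η + X * Z, ?_, Y ^ 2, ?_, ?_, ⟨0, ?_, X ^ 2 * Y + X * Y ^ 2 * Z, ?_, ?_, 0,
      ?_, 0, ?_, ?_⟩, (X ^ 2 * Y + X * Y ^ 2 * Z) * (X ^ 2 * η + X * Z) ^ 2, ?_, (X ^ 2 * Y +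
      X * Y ^ 2 * Z) * Y ^ 4, ?_, ?_⟩ <;>
      first
      | grind
      | repeat' first
          | assumption | apply add_mem | apply mul_mem | apply pow_mem | apply neg_mem
          | apply zero_mem | apply ofNat_mem
  · refine ⟨X * η ^ 2 + Z * η, ?_, Y * ξ, ?_, ?_, ⟨η, ?_, Z * ξ, ?_, ?_, 0, ?_, 0, ?_, ?_⟩,
      η * (X ^ 2 * η ^ 4 + Z ^ 2 * η ^ 2) + Z * X * η ^ 4 + (Z * X ^ 2 * η ^ 2 + Z * Y +
      X * η * Z ^ 2), ?_, Y * ξ ^ 2 + Z * Y ^ 2 * ξ ^ 3, ?_, ?_⟩ <;>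
      first
      | grind
      | repeat' first
          | assumption | apply add_mem | apply mul_mem | apply pow_mem | apply neg_mem
          | apply zero_mem | apply ofNat_mem

theorem split_two_E7_zero (h : Chart L R X Y Z ξ η) (hp : (2 : C) = 0)
    (hZ : Z ^ 2 + X ^ 3 + X * Y ^ 3 = 0) (hc : c = 0) :
    SplitThree L R (Z * (Z * ξ * η)) 0 ∧
      SplitThree L R ((Z * ξ * η) ^ 2) (c * (Z * ξ * η)) := by
  obtain ⟨hX, hY, _, _, _, _, _, _, _, _⟩ := h
  subst hc
  refine ⟨?_, ?_⟩
  · refine ⟨X ^ 2 * η, ?_, Y ^ 2, ?_, ?_, ⟨0, ?_, X ^ 2 * Y, ?_, ?_, 0, ?_, 0, ?_, ?_⟩,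
      X ^ 2 * Y * (X ^ 2 * η) ^ 2, ?_, X ^ 2 * Y * Y ^ 4, ?_, ?_⟩ <;>
      first
      | grind
      | repeat' first
          | assumption | apply add_mem | apply mul_mem | apply pow_mem | apply neg_mem
          | apply zero_mem | apply ofNat_mem
  · refine ⟨X * η ^ 2, ?_, Y * ξ, ?_, ?_, ⟨η, ?_, 0, ?_, ?_, 0, ?_, 0, ?_, ?_⟩, X ^ 2 * η ^ 5,
      ?_, Y * ξ ^ 2, ?_, ?_⟩ <;>
      first
      | grind
      | repeat' first
          | assumption | apply add_mem | apply mul_mem | apply pow_mem | apply neg_mem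
          | apply zero_mem | apply ofNat_mem

theorem split_two_E8_four (h : Chart L R X Y Z ξ η) (hp : (2 : C) = 0)
    (hZ : Z ^ 2 + X ^ 3 + Y ^ 5 + Z * X * Y = 0) (hc : c = 1) :
    IsSplit L R (Z * (Z * ξ * η)) ∧
      IsSplit L R ((Z * ξ * η) ^ 2 - c * (Z * ξ * η)) := by
  obtain ⟨hX, hY, _, _, _, _, _, _, _, _⟩ := h
  subst hc
  refine ⟨?_, ?_⟩
  · refine ⟨X ^ 2 * η, ?_, Y ^ 4 * ξ + Z, ?_, ?_⟩ <;>
      first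
      | grind
      | repeat' first
          | assumption | apply add_mem | apply mul_mem | apply pow_mem | apply neg_mem
          | apply zero_mem | apply ofNat_mem
  · refine ⟨X * η ^ 2, ?_, Y ^ 3 * ξ ^ 2, ?_, ?_⟩ <;>
      first
      | grind
      | repeat' first
          | assumption | apply add_mem | apply mul_mem | apply pow_mem | apply neg_mem
          | apply zero_mem | apply ofNat_mem

theorem split_two_E8_three (h : Chart L R X Y Z ξ η) (hp : (2 : C) = 0)
    (hZ : Z ^ 2 + X ^ 3 + Y ^ 5 + Z * Y ^ 3 = 0) (hc : c = 1) :
    SplitTwo L R (Z * (Z * ξ * η)) 0 ∧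
      SplitTwo L R ((Z * ξ * η) ^ 2) (c * (Z * ξ * η)) := by
  obtain ⟨hX, hY, _, _, _, _, _, _, _, _⟩ := h
  subst hc
  refine ⟨?_, ?_⟩
  · refine ⟨X ^ 2 * η, ?_, Y ^ 4 * ξ + Y ^ 2 * Z * ξ, ?_, ?_, 0, ?_, X * Y ^ 3 + X * Y * Z, ?_,
      ?_⟩ <;>
      first
      | grind
      | repeat' first
          | assumption | apply add_mem | apply mul_mem | apply pow_mem | apply neg_mem
          | apply zero_mem | apply ofNat_mem
  · refine ⟨X * η ^ 2, ?_, Y ^ 3 * ξ ^ 2 + Z * Y * ξ ^ 2, ?_, ?_, 0, ?_, Y * ξ, ?_, ?_⟩ <;>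
      first
      | grind
      | repeat' first
          | assumption | apply add_mem | apply mul_mem | apply pow_mem | apply neg_mem
          | apply zero_mem | apply ofNat_mem

theorem split_two_E8_two (h : Chart L R X Y Z ξ η) (hp : (2 : C) = 0)
    (hZ : Z ^ 2 + X ^ 3 + Y ^ 5 + Z * X * Y ^ 2 = 0) (hc : c = 1) :
    SplitThree L R (Z * (Z * ξ * η)) 0 ∧
      SplitThree L R ((Z * ξ * η) ^ 2) (c * (Z * ξ * η)) := by
  obtain ⟨hX, hY, _, _, _, _, _, _, _, _⟩ := h
  subst hc
  refine ⟨?_, ?_⟩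
  · refine ⟨X ^ 2 * η, ?_, Y ^ 4 * ξ + Y * Z, ?_, ?_, ⟨0, ?_, X * Y ^ 3 + X ^ 2 * Z, ?_, ?_, 0,
      ?_, 0, ?_, ?_⟩, (X * Y ^ 3 + X ^ 2 * Z) * (X ^ 2 * η) ^ 2, ?_, (X * Y ^ 3 +
      X ^ 2 * Z) * (Y ^ 4 * ξ + Y * Z) ^ 2, ?_, ?_⟩ <;>
      first
      | grind
      | repeat' first
          | assumption | apply add_mem | apply mul_mem | apply pow_mem | apply neg_mem
          | apply zero_mem | apply ofNat_mem
  · refine ⟨X * η ^ 2, ?_, Y ^ 3 * ξ ^ 2 + Z * ξ, ?_, ?_, ⟨Z * η ^ 2, ?_, Y * ξ, ?_, ?_, 0, ?_,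
      0, ?_, ?_⟩, Z * X ^ 2 * η ^ 6 + Z * X * η ^ 2 + X * η ^ 3, ?_, Z * Y ^ 4 * ξ ^ 4 +
      Z * Y ^ 3 * ξ ^ 2 + ξ * Z ^ 2 + Y ^ 7 * ξ ^ 5 + Z ^ 2 * Y * ξ ^ 3, ?_, ?_⟩ <;>
      first
      | grind
      | repeat' first
          | assumption | apply add_mem | apply mul_mem | apply pow_mem | apply neg_mem
          | apply zero_mem | apply ofNat_mem

theorem split_two_E8_one (h : Chart L R X Y Z ξ η) (hp : (2 : C) = 0)
    (hZ : Z ^ 2 + X ^ 3 + Y ^ 5 + Z * X * Y ^ 3 = 0) (hc : c = 0) :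
    SplitThree L R (Z * (Z * ξ * η)) 0 ∧
      SplitThree L R ((Z * ξ * η) ^ 2) (c * (Z * ξ * η)) := by
  obtain ⟨hX, hY, _, _, _, _, _, _, _, _⟩ := h
  subst hc
  refine ⟨?_, ?_⟩
  · refine ⟨X ^ 2 * η, ?_, Y ^ 4 * ξ + Y ^ 2 * Z, ?_, ?_, ⟨0, ?_, X * Y ^ 3 + X ^ 2 * Y * Z, ?_,
      ?_, 0, ?_, 0, ?_, ?_⟩, (X * Y ^ 3 + X ^ 2 * Y * Z) * (X ^ 2 * η) ^ 2, ?_, (X * Y ^ 3 +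
      X ^ 2 * Y * Z) * (Y ^ 4 * ξ + Y ^ 2 * Z) ^ 2, ?_, ?_⟩ <;>
      first
      | grind
      | repeat' first
          | assumption | apply add_mem | apply mul_mem | apply pow_mem | apply neg_mem
          | apply zero_mem | apply ofNat_mem
  · refine ⟨X * η ^ 2, ?_, Y ^ 3 * ξ ^ 2 + Z * Y * ξ, ?_, ?_, ⟨Z * η, ?_, Y * ξ, ?_, ?_, 0, ?_,
      Z * ξ, ?_, ?_⟩, Z * X ^ 2 * η ^ 5 + X * η ^ 3, ?_, Z * Y ^ 5 * ξ ^ 4 + Z ^ 3 * Y * ξ ^ 2 +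
      Y ^ 7 * ξ ^ 5 + Z ^ 2 * Y ^ 3 * ξ ^ 3, ?_, ?_⟩ <;>
      first
      | grind
      | repeat' first
          | assumption | apply add_mem | apply mul_mem | apply pow_mem | apply neg_mem
          | apply zero_mem | apply ofNat_mem

theorem split_two_E8_zero (h : Chart L R X Y Z ξ η) (hp : (2 : C) = 0)
    (hZ : Z ^ 2 + X ^ 3 + Y ^ 5 = 0) (hc : c = 0) :
    SplitThree L R (Z * (Z * ξ * η)) 0 ∧
      SplitThree L R ((Z * ξ * η) ^ 2) (c * (Z * ξ * η)) := by
  obtain ⟨hX, hY, _, _, _, _, _, _, _, _⟩ := h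
  subst hc
  refine ⟨?_, ?_⟩
  · refine ⟨X ^ 2 * η, ?_, Y ^ 4 * ξ, ?_, ?_, ⟨0, ?_, X * Y ^ 3, ?_, ?_, 0, ?_, 0, ?_, ?_⟩,
      X * Y ^ 3 * (X ^ 2 * η) ^ 2, ?_, X * Y ^ 3 * (Y ^ 4 * ξ) ^ 2, ?_, ?_⟩ <;>
      first
      | grind
      | repeat' first
          | assumption | apply add_mem | apply mul_mem | apply pow_mem | apply neg_mem
          | apply zero_mem | apply ofNat_mem
  · refine ⟨X * η ^ 2, ?_, Y ^ 3 * ξ ^ 2, ?_, ?_, ⟨0, ?_, Y * ξ, ?_, ?_, 0, ?_, 0, ?_, ?_⟩,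
      X * η ^ 3, ?_, Y ^ 7 * ξ ^ 5, ?_, ?_⟩ <;>
      first
      | grind
      | repeat' first
          | assumption | apply add_mem | apply mul_mem | apply pow_mem | apply neg_mem
          | apply zero_mem | apply ofNat_mem

theorem split_three_E6_zero (h : Chart L R X Y Z ξ η) (hp : (3 : C) = 0)
    (hZ : Z ^ 2 + X ^ 3 + Y ^ 4 = 0) (hc : c = 0) :
    IsSplit L R (Z * (Z * ξ * η)) ∧
      IsSplit L R ((Z * ξ * η) ^ 3 - c * (Z * ξ * η)) := by
  obtain ⟨hX, hY, _, _, _, _, _, _, _, _⟩ := h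
  subst hc
  refine ⟨?_, ?_⟩
  · refine ⟨-(X ^ 2 * η), ?_, -(Y ^ 3 * ξ), ?_, ?_⟩ <;>
      first
      | grind
      | repeat' first
          | assumption | apply add_mem | apply mul_mem | apply pow_mem | apply neg_mem
          | apply zero_mem | apply ofNat_mem
  · refine ⟨-(Z * η ^ 3), ?_, -(Z * Y * ξ ^ 3), ?_, ?_⟩ <;>
      first
      | grind
      | repeat' first
          | assumption | apply add_mem | apply mul_mem | apply pow_mem | apply neg_mem
          | apply zero_mem | apply ofNat_mem

theorem split_three_E6_one (h : Chart L R X Y Z ξ η) (hp : (3 : C) = 0)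
    (hZ : Z ^ 2 + X ^ 3 + Y ^ 4 + X ^ 2 * Y ^ 2 = 0) (hc : c = -1) :
    IsSplit L R (Z * (Z * ξ * η)) ∧
      IsSplit L R ((Z * ξ * η) ^ 3 - c * (Z * ξ * η)) := by
  obtain ⟨hX, hY, _, _, _, _, _, _, _, _⟩ := h
  subst hc
  refine ⟨?_, ?_⟩
  · refine ⟨-(X ^ 2 * η), ?_, -(Y ^ 3 * ξ + X * Y), ?_, ?_⟩ <;>
      first
      | grind
      | repeat' first
          | assumption | apply add_mem | apply mul_mem | apply pow_mem | apply neg_mem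
          | apply zero_mem | apply ofNat_mem
  · refine ⟨-(Z * η ^ 3), ?_, -(Z * Y * ξ ^ 3), ?_, ?_⟩ <;>
      first
      | grind
      | repeat' first
          | assumption | apply add_mem | apply mul_mem | apply pow_mem | apply neg_mem
          | apply zero_mem | apply ofNat_mem

theorem split_three_E7_zero (h : Chart L R X Y Z ξ η) (hp : (3 : C) = 0)
    (hZ : Z ^ 2 + X ^ 3 + X * Y ^ 3 = 0) (hc : c = 0) :
    IsSplit L R (Z * (Z * ξ * η)) ∧
      IsSplit L R ((Z * ξ * η) ^ 3 - c * (Z * ξ * η)) := by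
  obtain ⟨hX, hY, _, _, _, _, _, _, _, _⟩ := h
  subst hc
  refine ⟨?_, ?_⟩
  · refine ⟨-(X ^ 2 * η), ?_, -Y ^ 2, ?_, ?_⟩ <;>
      first
      | grind
      | repeat' first
          | assumption | apply add_mem | apply mul_mem | apply pow_mem | apply neg_mem
          | apply zero_mem | apply ofNat_mem
  · refine ⟨-(Z * η ^ 3), ?_, -(Z * ξ ^ 2), ?_, ?_⟩ <;>
      first
      | grind
      | repeat' first
          | assumption | apply add_mem | apply mul_mem | apply pow_mem | apply neg_mem
          | apply zero_mem | apply ofNat_mem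

theorem split_three_E7_one (h : Chart L R X Y Z ξ η) (hp : (3 : C) = 0)
    (hZ : Z ^ 2 + X ^ 3 + X * Y ^ 3 + X ^ 2 * Y ^ 2 = 0) (hc : c = -1) :
    IsSplit L R (Z * (Z * ξ * η)) ∧
      IsSplit L R ((Z * ξ * η) ^ 3 - c * (Z * ξ * η)) := by
  obtain ⟨hX, hY, _, _, _, _, _, _, _, _⟩ := h
  subst hc
  refine ⟨?_, ?_⟩
  · refine ⟨-(X ^ 2 * η), ?_, -(Y ^ 2 + X * Y), ?_, ?_⟩ <;>
      first
      | grind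
      | repeat' first
          | assumption | apply add_mem | apply mul_mem | apply pow_mem | apply neg_mem
          | apply zero_mem | apply ofNat_mem
  · refine ⟨-(Z * η ^ 3), ?_, -(Z * ξ ^ 2), ?_, ?_⟩ <;>
      first
      | grind
      | repeat' first
          | assumption | apply add_mem | apply mul_mem | apply pow_mem | apply neg_mem
          | apply zero_mem | apply ofNat_mem

theorem split_three_E8_zero (h : Chart L R X Y Z ξ η) (hp : (3 : C) = 0)
    (hZ : Z ^ 2 + X ^ 3 + Y ^ 5 = 0) (hc : c = 0) :
    SplitTwoThree L R (Z * (Z * ξ * η)) 0 ∧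
      SplitTwoThree L R ((Z * ξ * η) ^ 3) (c * (Z * ξ * η)) := by
  obtain ⟨hX, hY, _, _, _, _, _, _, _, _⟩ := h
  subst hc
  refine ⟨?_, ?_⟩
  · refine ⟨-(X ^ 2 * η), ?_, -(Y ^ 4 * ξ), ?_, ?_, -(X ^ 3 * Y ^ 2), ?_,
      -(X * Y ^ 3 * Y ^ 4 * ξ), ?_, ?_⟩ <;>
      first
      | grind
      | repeat' first
          | assumption | apply add_mem | apply mul_mem | apply pow_mem | apply neg_mem
          | apply zero_mem | apply ofNat_mem
  · refine ⟨-(Z * η ^ 3), ?_, -(Z * Y ^ 2 * ξ ^ 3), ?_, ?_, Z * η ^ 4, ?_, Z * Y ^ 6 * ξ ^ 6 +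
      2 * Y * ξ ^ 3 * Z, ?_, ?_⟩ <;>
      first
      | grind
      | repeat' first
          | assumption | apply add_mem | apply mul_mem | apply pow_mem | apply neg_mem
          | apply zero_mem | apply ofNat_mem

theorem split_three_E8_one (h : Chart L R X Y Z ξ η) (hp : (3 : C) = 0)
    (hZ : Z ^ 2 + X ^ 3 + Y ^ 5 + X ^ 2 * Y ^ 3 = 0) (hc : c = 1) :
    SplitTwoThree L R (Z * (Z * ξ * η)) 0 ∧
      SplitTwoThree L R ((Z * ξ * η) ^ 3) (c * (Z * ξ * η)) := by
  obtain ⟨hX, hY, _, _, _, _, _, _, _, _⟩ := h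
  subst hc
  refine ⟨?_, ?_⟩
  · refine ⟨-(X ^ 2 * η), ?_, -(Y ^ 4 * ξ + X * Y ^ 2), ?_, ?_, -((X * Y ^ 3 +
      X ^ 3 * Y) * (X ^ 2 * η)), ?_, -((X * Y ^ 3 + X ^ 3 * Y) * (Y ^ 4 * ξ + X * Y ^ 2)), ?_, ?_⟩
      <;>
      first
      | grind
      | repeat' first
          | assumption | apply add_mem | apply mul_mem | apply pow_mem | apply neg_mem
          | apply zero_mem | apply ofNat_mem
  · refine ⟨-(Z * η ^ 3), ?_, -(Z * Y ^ 2 * ξ ^ 3 + Z * ξ), ?_, ?_, Z * η ^ 4 +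
      X ^ 2 * η ^ 6 * Z + 2 * X * η ^ 3 * Z, ?_, Z * Y ^ 6 * ξ ^ 6 + 2 * Y * ξ ^ 3 * Z + Z, ?_, ?_⟩
      <;>
      first
      | grind
      | repeat' first
          | assumption | apply add_mem | apply mul_mem | apply pow_mem | apply neg_mem
          | apply zero_mem | apply ofNat_mem

theorem split_three_E8_two (h : Chart L R X Y Z ξ η) (hp : (3 : C) = 0)
    (hZ : Z ^ 2 + X ^ 3 + Y ^ 5 + X ^ 2 * Y ^ 2 = 0) (hc : c = -1) :
    IsSplit L R (Z * (Z * ξ * η)) ∧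
      IsSplit L R ((Z * ξ * η) ^ 3 - c * (Z * ξ * η)) := by
  obtain ⟨hX, hY, _, _, _, _, _, _, _, _⟩ := h
  subst hc
  refine ⟨?_, ?_⟩
  · refine ⟨-(X ^ 2 * η), ?_, -(Y ^ 4 * ξ + X * Y), ?_, ?_⟩ <;>
      first
      | grind
      | repeat' first
          | assumption | apply add_mem | apply mul_mem | apply pow_mem | apply neg_mem
          | apply zero_mem | apply ofNat_mem
  · refine ⟨-(Z * η ^ 3), ?_, -(Z * Y ^ 2 * ξ ^ 3), ?_, ?_⟩ <;>
      first
      | grind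
      | repeat' first
          | assumption | apply add_mem | apply mul_mem | apply pow_mem | apply neg_mem
          | apply zero_mem | apply ofNat_mem

theorem split_five_E8_zero (h : Chart L R X Y Z ξ η) (hp : (5 : C) = 0)
    (hZ : Z ^ 2 + X ^ 3 + Y ^ 5 = 0) (hc : c = 0) :
    IsSplit L R (Z * (Z * ξ * η)) ∧
      IsSplit L R ((Z * ξ * η) ^ 5 - c * (Z * ξ * η)) := by
  obtain ⟨hX, hY, _, _, _, _, _, _, _, _⟩ := h
  subst hc
  refine ⟨?_, ?_⟩
  · refine ⟨-(X ^ 2 * η), ?_, -(Y ^ 4 * ξ), ?_, ?_⟩ <;>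
      first
      | grind
      | repeat' first
          | assumption | apply add_mem | apply mul_mem | apply pow_mem | apply neg_mem
          | apply zero_mem | apply ofNat_mem
  · refine ⟨X * Z * η ^ 5, ?_, Y ^ 5 * ξ ^ 5 * Z + 2 * ξ ^ 2 * Z, ?_, ?_⟩ <;>
      first
      | grind
      | repeat' first
          | assumption | apply add_mem | apply mul_mem | apply pow_mem | apply neg_mem
          | apply zero_mem | apply ofNat_mem

theorem split_five_E8_one (h : Chart L R X Y Z ξ η) (hp : (5 : C) = 0)
    (hZ : Z ^ 2 + X ^ 3 + Y ^ 5 + X * Y ^ 4 = 0) (hc : c = 2) :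
    IsSplit L R (Z * (Z * ξ * η)) ∧
      IsSplit L R ((Z * ξ * η) ^ 5 - c * (Z * ξ * η)) := by
  obtain ⟨hX, hY, _, _, _, _, _, _, _, _⟩ := h
  subst hc
  refine ⟨?_, ?_⟩
  · refine ⟨-(X ^ 2 * η), ?_, -(Y ^ 4 * ξ + Y ^ 3), ?_, ?_⟩ <;>
      first
      | grind
      | repeat' first
          | assumption | apply add_mem | apply mul_mem | apply pow_mem | apply neg_mem
          | apply zero_mem | apply ofNat_mem
  · refine ⟨X * Z * η ^ 5, ?_, Y ^ 5 * ξ ^ 5 * Z + ξ ^ 3 * Y ^ 3 * Z + 2 * ξ ^ 2 * Z +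
      2 * ξ ^ 4 * Y ^ 4 * Z, ?_, ?_⟩ <;>
      first
      | grind
      | repeat' first
          | assumption | apply add_mem | apply mul_mem | apply pow_mem | apply neg_mem
          | apply zero_mem | apply ofNat_mem

end

end WittLC

/-! ### The class of `[z / (xy)]` on Artin's double points -/

namespace WittLC

open IsLocalRing RDP

section

variable {p : ℕ} [Fact p.Prime] {B : Type*} [CommRing B] {x y z c : B}

theorem algebraMap_mem_left (b : B) :
    algebraMap B (Localization.Away (x * y)) b ∈ (locLeft x y).range :=
  ⟨algebraMap B _ b, IsLocalization.Away.awayToAwayRight_eq x y b⟩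

theorem algebraMap_mem_right (b : B) :
    algebraMap B (Localization.Away (x * y)) b ∈ (locRight x y).range :=
  ⟨algebraMap B _ b, IsLocalization.Away.awayToAwayLeft_eq y x b⟩

theorem exists_chart (x y z : B) : ∃ ξ η : Localization.Away (x * y),
    Chart (locLeft x y).range (locRight x y).range (algebraMap B _ x) (algebraMap B _ y)
      (algebraMap B _ z) ξ η ∧ IsLocalization.Away.invSelf (x * y) = ξ * η := by
  have hx := congrArg (locLeft x y)
    (IsLocalization.Away.mul_invSelf (S := Localization.Away x) x)
  have hy := congrArg (locRight x y)
    (IsLocalization.Away.mul_invSelf (S := Localization.Away y) y)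
  rw [map_mul, map_one, IsLocalization.Away.awayToAwayRight_eq x y x] at hx
  rw [map_mul, map_one, IsLocalization.Away.awayToAwayLeft_eq y x y] at hy
  refine ⟨_, _, ⟨hx, hy, algebraMap_mem_left _, algebraMap_mem_left _, algebraMap_mem_left _,
    ⟨_, rfl⟩, algebraMap_mem_right _, algebraMap_mem_right _, algebraMap_mem_right _, ⟨_, rfl⟩⟩, ?_⟩
  have h := IsLocalization.Away.mul_invSelf (S := Localization.Away (x * y)) (x * y)
  rw [map_mul] at h
  set ξ := locLeft x y (IsLocalization.Away.invSelf x)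
  set η := locRight x y (IsLocalization.Away.invSelf y)
  set i := IsLocalization.Away.invSelf (S := Localization.Away (x * y)) (x * y)
  linear_combination ξ * η * h - i * algebraMap B _ y * η * hx - i * hy

/-- The element `z / (xy)` of `B[1/(xy)]`. -/
abbrev ratio (x y z : B) : Localization.Away (x * y) :=
  algebraMap B _ z * IsLocalization.Away.invSelf (x * y)

theorem TeichFrobenius.of_isSplit
    (h : IsSplit (locLeft x y).range (locRight x y).range
      (algebraMap B (Localization.Away (x * y)) z * ratio x y z) ∧
      IsSplit (locLeft x y).range (locRight x y).range
        (ratio x y z ^ p - algebraMap B _ c * ratio x y z)) :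
    TeichFrobenius p le_rfl x y z c :=
  ⟨teich_one_mem h.1, teich_one_sub_mem h.2⟩

theorem TeichFrobenius.of_splitTwo (h2 : (2 : Localization.Away (x * y)) = 0)
    (h : SplitTwo (locLeft x y).range (locRight x y).range
      (algebraMap B (Localization.Away (x * y)) z * ratio x y z) 0 ∧
      SplitTwo (locLeft x y).range (locRight x y).range
        (ratio x y z ^ 2) (algebraMap B _ c * ratio x y z)) :
    TeichFrobenius 2 (Nat.le_succ 1) x y z c := by
  obtain ⟨⟨t, ht, v, hv, e, h⟩, ⟨t', ht', v', hv', e', h'⟩⟩ := h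
  refine ⟨?_, ?_⟩
  · have := teich_two_length_two_mem h2 ht hv h
    rwa [teich_zero, map_zero, sub_zero, ← e] at this
  · rw [e']
    exact teich_two_length_two_mem h2 ht' hv' h'

theorem TeichFrobenius.of_splitTwoThree
    (h : SplitTwoThree (locLeft x y).range (locRight x y).range
      (algebraMap B (Localization.Away (x * y)) z * ratio x y z) 0 ∧
      SplitTwoThree (locLeft x y).range (locRight x y).range
        (ratio x y z ^ 3) (algebraMap B _ c * ratio x y z)) :
    TeichFrobenius 3 (Nat.le_succ 1) x y z c := by
  obtain ⟨⟨t, ht, v, hv, e, h⟩, ⟨t', ht', v', hv', e', h'⟩⟩ := h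
  refine ⟨?_, ?_⟩
  · have := teich_three_length_two_mem ht hv h
    rwa [teich_zero, map_zero, sub_zero, ← e] at this
  · rw [e']
    exact teich_three_length_two_mem ht' hv' h'

theorem TeichFrobenius.of_splitThree (h2 : (2 : Localization.Away (x * y)) = 0)
    (h : SplitThree (locLeft x y).range (locRight x y).range
      (algebraMap B (Localization.Away (x * y)) z * ratio x y z) 0 ∧
      SplitThree (locLeft x y).range (locRight x y).range
        (ratio x y z ^ 2) (algebraMap B _ c * ratio x y z)) :
    TeichFrobenius 2 (by omega : 1 ≤ 3) x y z c := by
  obtain ⟨⟨t, ht, v, hv, e, ⟨s, hs, w, hw, f, h⟩, k⟩,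
    ⟨t', ht', v', hv', e', ⟨s', hs', w', hw', f', h'⟩, k'⟩⟩ := h
  refine ⟨?_, ?_⟩
  · have := teich_two_length_three_mem h2 ht hv f hs hw h k
    rwa [teich_zero, map_zero, sub_zero, ← e] at this
  · rw [e']
    exact teich_two_length_three_mem h2 ht' hv' f' hs' hw' h' k'

open EType in
/-- The length up to which `[z / (xy)]` has the desired properties, case by case. The Frobenius does
not vanish in this length exactly if `r + N = r_max + 1`. -/
theorem exists_teichFrobenius [CharP B p] (S : EType) (r n : ℕ) (hn : 1 ≤ n)
    (hcase : (p = 2 ∧ (S = E7 ∨ S = E8) ∧ n ≤ 3) ∨ (p = 3 ∧ S = E8 ∧ n ≤ 2) ∨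
      (p = 2 ∧ S = E6 ∧ n = 1) ∨ (p = 3 ∧ (S = E6 ∨ S = E7) ∧ n = 1) ∨ (p = 5 ∧ S = E8 ∧ n = 1))
    (hr : r + n ≤ rMax p S + 1) (heq : equationZero x y z p S + extraTerm x y z p S r = 0) :
    ∃ (N : ℕ) (hN : 1 ≤ N) (c : B), TeichFrobenius p hN x y z c ∧ n ≤ N ∧
      (r + N = rMax p S + 1 ∧ IsUnit c ∨ r + N < rMax p S + 1 ∧ c = 0) := by
  obtain ⟨ξ, η, hch, hinv⟩ := exists_chart x y z
  have hp := natCast_localization_eq_zero p (Submonoid.powers (x * y))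
  have hw : ratio x y z = algebraMap B _ z * ξ * η := by rw [ratio, hinv, mul_assoc]
  have hZ := congrArg (algebraMap B (Localization.Away (x * y))) heq
  have h0 := map_zero (algebraMap B (Localization.Away (x * y)))
  have h1 := map_one (algebraMap B (Localization.Away (x * y)))
  have hneg : algebraMap B (Localization.Away (x * y)) (-1) = -1 := by rw [map_neg, map_one]
  have h2 := map_ofNat (algebraMap B (Localization.Away (x * y))) 2
  have hunit : IsUnit (-1 : B) := isUnit_one.neg
  rcases hcase with ⟨rfl, rfl | rfl, hn3⟩ | ⟨rfl, rfl, hn2⟩ | ⟨rfl, rfl, rfl⟩ |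
    ⟨rfl, rfl | rfl, rfl⟩ | ⟨rfl, rfl, rfl⟩ <;> simp only [rMax] at hr ⊢ <;>
    have hr' : r ≤ 4 := by omega
  · have : r ≤ 3 := by omega
    interval_cases r <;>
      simp only [equationZero, extraTerm, map_add, map_mul, map_pow, map_zero, add_zero] at hZ
    · exact ⟨3, by omega, 0, .of_splitThree hp (by
        rw [hw]; exact split_two_E7_zero hch hp hZ h0), by omega, by simp⟩
    · exact ⟨3, by omega, 1, .of_splitThree hp (by
        rw [hw]; exact split_two_E7_one hch hp hZ h1), by omega, by simp⟩
    · exact ⟨2, by omega, 1, .of_splitTwo hp (by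
        rw [hw]; exact split_two_E7_two hch hp hZ h1), by omega, by simp⟩
    · exact ⟨1, by omega, 1, .of_isSplit (by
        rw [hw]; exact split_two_E7_three hch hp hZ h1), by omega, by simp⟩
  · interval_cases r <;>
      simp only [equationZero, extraTerm, map_add, map_mul, map_pow, map_zero, add_zero] at hZ
    · exact ⟨3, by omega, 0, .of_splitThree hp (by
        rw [hw]; exact split_two_E8_zero hch hp hZ h0), by omega, by simp⟩
    · exact ⟨3, by omega, 0, .of_splitThree hp (by
        rw [hw]; exact split_two_E8_one hch hp hZ h0), by omega, by simp⟩
    · exact ⟨3, by omega, 1, .of_splitThree hp (by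
        rw [hw]; exact split_two_E8_two hch hp hZ h1), by omega, by simp⟩
    · exact ⟨2, by omega, 1, .of_splitTwo hp (by
        rw [hw]; exact split_two_E8_three hch hp hZ h1), by omega, by simp⟩
    · exact ⟨1, by omega, 1, .of_isSplit (by
        rw [hw]; exact split_two_E8_four hch hp hZ h1), by omega, by simp⟩
  · have : r ≤ 2 := by omega
    interval_cases r <;>
      simp only [equationZero, extraTerm, map_add, map_mul, map_pow, map_zero, add_zero] at hZ
    · exact ⟨2, by omega, 0, .of_splitTwoThree (by
        rw [hw]; exact split_three_E8_zero hch hp hZ h0), by omega, by simp⟩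
    · exact ⟨2, by omega, 1, .of_splitTwoThree (by
        rw [hw]; exact split_three_E8_one hch hp hZ h1), by omega, by simp⟩
    · exact ⟨1, by omega, -1, .of_isSplit (by
        rw [hw]; exact split_three_E8_two hch hp hZ hneg), by omega, by simp⟩
  · have : r ≤ 1 := by omega
    interval_cases r <;>
      simp only [equationZero, extraTerm, map_add, map_mul, map_pow, map_zero, add_zero] at hZ
    · exact ⟨1, by omega, 0, .of_isSplit (by
        rw [hw]; exact split_two_E6_zero hch hp hZ h0), by omega, by simp⟩
    · exact ⟨1, by omega, 1, .of_isSplit (by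
        rw [hw]; exact split_two_E6_one hch hp hZ h1), by omega, by simp⟩
  · have : r ≤ 1 := by omega
    interval_cases r <;>
      simp only [equationZero, extraTerm, map_add, map_mul, map_pow, map_zero, add_zero] at hZ
    · exact ⟨1, by omega, 0, .of_isSplit (by
        rw [hw]; exact split_three_E6_zero hch hp hZ h0), by omega, by simp⟩
    · exact ⟨1, by omega, -1, .of_isSplit (by
        rw [hw]; exact split_three_E6_one hch hp hZ hneg), by omega, by simp⟩
  · have : r ≤ 1 := by omega
    interval_cases r <;>
      simp only [equationZero, extraTerm, map_add, map_mul, map_pow, map_zero, add_zero] at hZ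
    · exact ⟨1, by omega, 0, .of_isSplit (by
        rw [hw]; exact split_three_E7_zero hch hp hZ h0), by omega, by simp⟩
    · exact ⟨1, by omega, -1, .of_isSplit (by
        rw [hw]; exact split_three_E7_one hch hp hZ hneg), by omega, by simp⟩
  · have : r ≤ 1 := by omega
    have h5 : ((5 : ℕ) : B) = 0 := CharP.cast_eq_zero B 5
    -- `2 * 3 = 1` in characteristic five
    have hunit2 : IsUnit (2 : B) := IsUnit.of_mul_eq_one 3 (by
      push_cast at h5
      linear_combination h5)
    interval_cases r <;>
      simp only [equationZero, extraTerm, map_add, map_mul, map_pow, map_zero, add_zero] at hZ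
    · exact ⟨1, by omega, 0, .of_isSplit (by
        rw [hw]; exact split_five_E8_zero hch hp hZ h0), by omega, by simp⟩
    · exact ⟨1, by omega, 2, .of_isSplit (by
        rw [hw]; exact split_five_E8_one hch hp hZ h2), by omega, by simp [hunit2]⟩

open EType in
theorem hasFrobeniusClass_of_equation [IsLocalRing B] [CharP B p] (hD : IsDoubleCover x y z)
    (S : EType) (r n : ℕ) (hn : 1 ≤ n)
    (hcase : (p = 2 ∧ (S = E7 ∨ S = E8) ∧ n ≤ 3) ∨ (p = 3 ∧ S = E8 ∧ n ≤ 2) ∨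
      (p = 2 ∧ S = E6 ∧ n = 1) ∨ (p = 3 ∧ (S = E6 ∨ S = E7) ∧ n = 1) ∨ (p = 5 ∧ S = E8 ∧ n = 1))
    (hr : r + n ≤ rMax p S + 1) (heq : equationZero x y z p S + extraTerm x y z p S r = 0) :
    HasFrobeniusClass p hn x y (maximalIdeal B) (r + n < rMax p S + 1) (r + n = rMax p S + 1) := by
  obtain ⟨N, hN, c, h, hnN, hc⟩ := exists_teichFrobenius S r n hn hcase hr heq
  rcases hnN.eq_or_lt with rfl | hlt
  · refine h.hasFrobeniusClass hD (fun hP => ?_) (fun hQ => ?_)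
    · rcases hc with hc | hc
      · omega
      · exact hc.2
    · rcases hc with hc | hc
      · exact hc.2
      · omega
  · exact (h.of_lt hn hlt).hasFrobeniusClass hD (fun _ => rfl) (fun hQ => by omega)

end

end WittLC

/-! ### Passage to the completion -/

namespace WittLC

open IsLocalRing RDP

theorem map_span_pair_pow {A B : Type*} [CommRing A] [CommRing B] (f : A →+* B) (x y : A) (N : ℕ) :
    (Ideal.span {x ^ N, y ^ N}).map f = Ideal.span {f x ^ N, f y ^ N} := by
  rw [Ideal.map_span, Set.image_pair, map_pow, map_pow]

section Completion

variable {A : Type*} [CommRing A] [IsLocalRing A]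

/-- Elements of the completion are congruent to elements of `A` modulo every ideal that is generated
by elements of `A` and contains a power of the maximal ideal. -/
theorem exists_sub_algebraMap_mem_map [IsNoetherianRing A] (J : Ideal A) (K : ℕ)
    (hK : maximalIdeal A ^ K ≤ J) (b : AdicCompletion (maximalIdeal A) A) :
    ∃ a : A, b - algebraMap A _ a ∈ J.map (algebraMap A (AdicCompletion (maximalIdeal A) A)) := by
  obtain ⟨a, ha⟩ := Ideal.Quotient.mk_surjective (AdicCompletion.eval (maximalIdeal A) A K b)
  refine ⟨a, Ideal.map_mono hK ?_⟩
  have h : b - algebraMap A _ a ∈ (AdicCompletion.eval (maximalIdeal A) A K).ker := by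
    rw [LinearMap.mem_ker, map_sub, ← ha, sub_eq_zero]
    rfl
  rw [← AdicCompletion.pow_smul_top_eq_ker_eval (maximalIdeal A).fg_of_isNoetherianRing,
    Ideal.smul_top_eq_map] at h
  exact h

/-- An ideal of `A` that contains a power of the maximal ideal is the contraction of its extension
to the completion. -/
theorem mem_of_algebraMap_mem_map (J : Ideal A) (K : ℕ) (hK : maximalIdeal A ^ K ≤ J) {a : A}
    (ha : algebraMap A (AdicCompletion (maximalIdeal A) A) a ∈
      J.map (algebraMap A (AdicCompletion (maximalIdeal A) A))) : a ∈ J := by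
  have h := Ideal.mem_map_of_mem
    ((Ideal.Quotient.factor hK).comp (AdicCompletion.evalₐ (maximalIdeal A) K).toRingHom) ha
  rw [Ideal.map_map] at h
  have hcomp : (((Ideal.Quotient.factor hK).comp
      (AdicCompletion.evalₐ (maximalIdeal A) K).toRingHom).comp
        (algebraMap A (AdicCompletion (maximalIdeal A) A))) = Ideal.Quotient.mk J := by
    ext b
    have : AdicCompletion.evalₐ (maximalIdeal A) K (algebraMap A _ b) =
      Ideal.Quotient.mk _ b := AdicCompletion.evalₐ_of (maximalIdeal A) K b
    simp [this]
  rw [hcomp, Ideal.map_quotient_self] at h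
  have h' := Ideal.mem_bot.mp h
  rw [← RingHom.comp_apply, hcomp] at h'
  exact Ideal.Quotient.eq_zero_iff_mem.mp h'

theorem exists_maximalIdeal_pow_le [IsNoetherianRing A] {x y : A}
    (hxy : (Ideal.span {x, y}).radical = maximalIdeal A) (N : ℕ) :
    ∃ K, maximalIdeal A ^ K ≤ Ideal.span {x ^ N, y ^ N} := by
  have hrad : maximalIdeal A ≤ (Ideal.span {x ^ N, y ^ N}).radical := by
    rw [← hxy, Ideal.radical_le_radical_iff, Ideal.span_le]
    rintro a (rfl | rfl)
    · exact ⟨N, Ideal.subset_span (by simp)⟩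
    · exact ⟨N, Ideal.subset_span (by simp)⟩
  exact Ideal.exists_pow_le_of_le_radical_of_fg hrad (maximalIdeal A).fg_of_isNoetherianRing

/-- The local cohomology of a Noetherian local ring agrees with that of its completion, and a system
of parameters stays one in the completion. -/
theorem nonempty_locCohIso_completion [IsNoetherianRing A] {B : Type*} [CommRing B] [IsLocalRing B]
    (p : ℕ) [Fact p.Prime] [CharP A p] [CharP B p]
    (φ : AdicCompletion (maximalIdeal A) A ≃+* B) {x y : A}
    (hxy : (Ideal.span {x, y}).radical = maximalIdeal A) :
    let f := (φ : AdicCompletion (maximalIdeal A) A →+* B).comp (algebraMap A _)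
    (Ideal.span {f x, f y}).radical = maximalIdeal B ∧
      Nonempty (LocCohIso p x y (maximalIdeal A) (f x) (f y) (maximalIdeal B)) := by
  intro f
  have hI : ∀ a, f a ∈ maximalIdeal B ↔ a ∈ maximalIdeal A := fun a => by
    rw [mem_maximalIdeal, mem_maximalIdeal, mem_nonunits_iff, mem_nonunits_iff]
    have : IsUnit (f a) ↔ IsUnit a := by
      rw [← isUnit_map_iff (algebraMap A (AdicCompletion (maximalIdeal A) A)) a]
      exact MulEquiv.isUnit_map φ
    rw [this]
  have hspan : ∀ N, Ideal.span {f x ^ N, f y ^ N} =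
      ((Ideal.span {x ^ N, y ^ N}).map (algebraMap A _)).map
        (φ : AdicCompletion (maximalIdeal A) A →+* B) := fun N => by
    rw [Ideal.map_map, map_span_pair_pow]
  have hsurj : ∀ (N : ℕ) (b : B), ∃ a, b - f a ∈ Ideal.span {f x ^ N, f y ^ N} := fun N b => by
    obtain ⟨K, hK⟩ := exists_maximalIdeal_pow_le hxy N
    obtain ⟨b, rfl⟩ := φ.surjective b
    obtain ⟨a, ha⟩ := exists_sub_algebraMap_mem_map _ K hK b
    refine ⟨a, ?_⟩
    rw [hspan]
    have := Ideal.mem_map_of_mem (φ : AdicCompletion (maximalIdeal A) A →+* B) ha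
    rwa [map_sub] at this
  have hinj : ∀ (N : ℕ) (a : A), f a ∈ Ideal.span {f x ^ N, f y ^ N} →
      a ∈ Ideal.span {x ^ N, y ^ N} := fun N a ha => by
    obtain ⟨K, hK⟩ := exists_maximalIdeal_pow_le hxy N
    rw [hspan] at ha
    obtain ⟨b, hb, e⟩ := (Ideal.mem_map_of_equiv φ _).mp ha
    rw [φ.injective e] at hb
    exact mem_of_algebraMap_mem_map _ K hK hb
  have hx : x ∈ maximalIdeal A := hxy ▸ Ideal.le_radical (Ideal.subset_span (by simp))
  have hy : y ∈ maximalIdeal A := hxy ▸ Ideal.le_radical (Ideal.subset_span (by simp))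
  refine ⟨le_antisymm ?_ fun b hb => ?_, nonempty_locCohIso_of_dense f x y hsurj hinj hI hx hy⟩
  · refine (Ideal.IsPrime.radical_le_iff inferInstance).mpr (Ideal.span_le.mpr ?_)
    rintro _ (rfl | rfl)
    exacts [(hI x).mpr hx, (hI y).mpr hy]
  · obtain ⟨a, ha⟩ := hsurj 1 b
    simp only [pow_one] at ha
    have hle : Ideal.span {f x, f y} ≤ maximalIdeal B := Ideal.span_le.mpr (by
      rintro _ (rfl | rfl)
      exacts [(hI x).mpr hx, (hI y).mpr hy])
    have haA : a ∈ maximalIdeal A := (hI a).mp (by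
      have := sub_mem hb (hle ha)
      rwa [sub_sub_cancel] at this)
    rw [← hxy] at haA
    obtain ⟨m, hm⟩ := haA
    have hfa : f a ∈ (Ideal.span {f x, f y}).radical := ⟨m, by
      have := Ideal.mem_map_of_mem f hm
      rwa [Ideal.map_span, Set.image_pair, map_pow] at this⟩
    have := add_mem (Ideal.le_radical ha) hfa
    rwa [sub_add_cancel] at this

end Completion

/-! ### Artin's equations -/

section Artin

/-- Artin's equations are monic of degree two in `z` with lower coefficients in `(x, y)`. -/
theorem exists_equationZero_eq {R : Type*} [CommRing R] (x y z : R) (p : ℕ) (S : EType) :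
    ∃ U V, equationZero x y z p S = z ^ 2 + x * U + y * V := by
  unfold equationZero
  split
  exacts [⟨x ^ 2, y * z, by ring⟩, ⟨x ^ 2, y ^ 3, by ring⟩, ⟨x ^ 2, x * y ^ 2, by ring⟩,
    ⟨x ^ 2, y ^ 4, by ring⟩]

theorem exists_extraTerm_eq {R : Type*} [CommRing R] (x y z : R) (p : ℕ) (S : EType) (r : ℕ) :
    ∃ V, extraTerm x y z p S r = y * V := by
  unfold extraTerm
  split
  exacts [⟨x * z, by ring⟩, ⟨z * x, by ring⟩, ⟨z * y ^ 2, by ring⟩, ⟨z * x ^ 2, by ring⟩,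
    ⟨z * x, by ring⟩, ⟨z * y ^ 2, by ring⟩, ⟨z * x * y, by ring⟩, ⟨z * x * y ^ 2, by ring⟩,
    ⟨x ^ 2 * y, by ring⟩, ⟨x ^ 2 * y, by ring⟩, ⟨x ^ 2 * y, by ring⟩, ⟨x ^ 2 * y ^ 2, by ring⟩,
    ⟨x * y ^ 3, by ring⟩, ⟨0, by ring⟩]

theorem map_equationZero {R R' : Type*} [CommRing R] [CommRing R'] (f : R →+* R') (x y z : R)
    (p : ℕ) (S : EType) :
    f (equationZero x y z p S) = equationZero (f x) (f y) (f z) p S := by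
  unfold equationZero
  split <;> simp only [map_add, map_mul, map_pow]

theorem map_extraTerm {R R' : Type*} [CommRing R] [CommRing R'] (f : R →+* R') (x y z : R)
    (p : ℕ) (S : EType) (r : ℕ) :
    f (extraTerm x y z p S r) = extraTerm (f x) (f y) (f z) p S r := by
  unfold extraTerm
  split <;> simp only [map_mul, map_pow, map_zero]

end Artin

end WittLC

theorem proposition4p7 {k : Type u} [Field k] [IsAlgClosed k] (p : ℕ) [Fact p.Prime] [CharP k p]
    {A : Type v} [CommRing A] [IsLocalRing A] [IsNoetherianRing A] [Algebra k A] [CharP A p]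
    (S : RDP.EType) (r n : ℕ) (hn : 1 ≤ n)
    (hcase : (p = 2 ∧ (S = RDP.EType.E7 ∨ S = RDP.EType.E8) ∧ n ≤ 3) ∨
      (p = 3 ∧ S = RDP.EType.E8 ∧ n ≤ 2) ∨
      (p = 2 ∧ S = RDP.EType.E6 ∧ n = 1) ∨
      (p = 3 ∧ (S = RDP.EType.E6 ∨ S = RDP.EType.E7) ∧ n = 1) ∨
      (p = 5 ∧ S = RDP.EType.E8 ∧ n = 1))
    (hA : RDP.IsOfType k A p S r) (hr : r + n ≤ RDP.rMax p S + 1)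
    (x y : A) (hxy : (Ideal.span {x, y}).radical = IsLocalRing.maximalIdeal A) :
    ∃ e ∈ WittLC.LocCoh.torsion p hn x y (IsLocalRing.maximalIdeal A),
      WittLC.LocCoh.IsGenerator (IsLocalRing.maximalIdeal A) (WittLC.LocCoh.R p hn x y e) ∧
      (r + n < RDP.rMax p S + 1 → WittLC.LocCoh.F p n x y e = 0) ∧
      (r + n = RDP.rMax p S + 1 →
        ∃ e' ∈ WittLC.LocCoh.torsion p le_rfl x y (IsLocalRing.maximalIdeal A),
          WittLC.LocCoh.IsGenerator (IsLocalRing.maximalIdeal A) e' ∧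
          WittLC.LocCoh.F p n x y e = WittLC.LocCoh.V p hn x y e') := by
  obtain ⟨-, ⟨φ⟩⟩ := hA
  have : IsLocalRing (MvPowerSeries (Fin 3) k ⧸ Ideal.span {RDP.equation k p S r}) :=
    φ.toRingEquiv.isLocalRing
  have : CharP (MvPowerSeries (Fin 3) k ⧸ Ideal.span {RDP.equation k p S r}) p :=
    charP_of_injective_algebraMap (algebraMap k _).injective p
  have : Infinite k := IsAlgClosed.instInfinite
  obtain ⟨U, V, hU⟩ := WittLC.exists_equationZero_eq (MvPowerSeries.X 0 : MvPowerSeries (Fin 3) k)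
    (MvPowerSeries.X 1) (MvPowerSeries.X 2) p S
  obtain ⟨V', hV'⟩ := WittLC.exists_extraTerm_eq (MvPowerSeries.X 0 : MvPowerSeries (Fin 3) k)
    (MvPowerSeries.X 1) (MvPowerSeries.X 2) p S r
  have hD := WittLC.isDoubleCover_of_eq (f := RDP.equation k p S r) (U := U) (V := V + V') (by
    rw [RDP.equation, hU, hV']
    ring)
  have heq := Ideal.Quotient.eq_zero_iff_mem.mpr
    (Ideal.mem_span_singleton_self (RDP.equation k p S r))
  rw [RDP.equation, map_add, WittLC.map_equationZero, WittLC.map_extraTerm] at heq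
  have hB := WittLC.hasFrobeniusClass_of_equation hD S r n hn hcase hr heq
  obtain ⟨hrad, ⟨Ψ⟩⟩ := WittLC.nonempty_locCohIso_completion p φ.toRingEquiv hxy
  obtain ⟨Φ⟩ := WittLC.nonempty_locCohIso_of_radical_eq p k hD.radical_eq hrad
    (IsLocalRing.maximalIdeal _)
  exact (hB.of_iso Φ).of_iso Ψ.symm

end
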